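/- Let $n\ge 1$ and $m\ge 0$, let $[n]$ be a set of agents and $\mathcal M=[m]$ a set of indivisible items, and let $v_i(g)\ge 0$ be the value of item $g$ for agent $i$, with $v_i(S)=\sum_{g\in S}v_i(g)$ for $S\subseteq\mathcal M$. An allocation of $S\subseteq\mathcal M$ is an ordered partition $A=(A_1,\dots,A_n)$ of $S$ (bundles may be empty). Put $\mathrm{NW}(A)=\bigl(\prod_{i}v_i(A_i)\bigr)^{1/n}$ and let $\mathrm{opt}(\mathcal M)$ be the maximum of $\mathrm{NW}$ over all allocations of $\mathcal M$. Write $d_i(S)=\max_{g\in S}v_i(S\setminus\{g\})$, with $d_i(\emptyset)=0$. The allocation $A$ is EFX if $v_i(A_i)\ge d_i(A_j)$ for all $i,j$. An allocation $A$ of $S$ is Pareto-optimal if there is no allocation $B$ of $S$ with $v_i(B_i)\ge v_i(A_i)$ for all $i$ and strict inequality for some $i$. Consider the following algorithm, whose input is $v$ and an allocation $X$ of $\mathcal M$ with $\mathrm{NW}(X)=\mathrm{opt}(\mathcal M)$. Start with $Z=X$. In each round, let $G$ be the bipartite graph between the agents and the bundles $Z_1,\dots,Z_n$ (distinguished by their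 indices) in which $(i,Z_j)$ is an edge iff $v_i(Z_j)\ge d_i(Z_k)$ for all $k$ and, in case $i\ne j$, also $v_i(Z_j)>v_i(Z_i)$. Choose a matching $M$ in $G$ that (a) matches every bundle with $Z_j\ne X_j$, (b) under (a) contains the maximum number of edges of the form $(i,Z_i)$, and (c) under (a) and (b) has maximum size. If $|M|=n$, stop and return the allocation $Y$ that gives to each agent the bundle matched to her. Otherwise choose an unmatched agent $i$, a bundle $Z_j$ for which $d_i(Z_j)$ is maximum and an item of $Z_j$ of least value for $i$, remove this item from $Z_j$, and start the next round. All choices are arbitrary. For every such input the following hold. 1. However the choices are made, every step can be carried out (in particular, a matching with (a) exists in every round), and the algorithm stops after at most $m$ removals. The algorithm can be implemented in polynomial time: there are one program for a random access machine with natural and real memory cells, whose unit-cost operations are addition, subtraction and comparison, and one polynomial $p$, such that on every such input the program halts within $p(n+m)$ steps with an output $Y$ that the algorithm returns for some sequence of choices. 2. Every $Y$ that the algorithm may return is an EFX allocation of $\bigcup_i Y_i$ with $2^{1-1/n}\cdot\mathrm{NW}(Y)\ge\mathrm{opt}(\mathcal M)$. 3. If $\mathrm{opt}(\mathcal M)>0$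 or all values $v_i(g)$ are positive, then $Y_i\subseteq X_i$ for every agent $i$. 4. If $\mathrm{opt}(\mathcal M)>0$, then $Y$ is a Pareto-optimal allocation of $\bigcup_i Y_i$; moreover $2v_i(Y_i)\ge v_i(X_i)$ for every $i$, and $Y_i=X_i$ for some $i$. -/

import Mathlib

open Finset

namespace FairDivision

section Allocations

variable {n m : ℕ}

/-- The additive value of agent `i` for the bundle `S`. -/
def value (v : Fin n → Fin m → ℝ) (i : Fin n) (S : Finset (Fin m)) : ℝ := ∑ g ∈ S, v i g

/-- `A` is an allocation of the item set `S`: an ordered partition of `S` into `n` bundles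
(some of which may be empty). -/
def IsAllocation (S : Finset (Fin m)) (A : Fin n → Finset (Fin m)) : Prop :=
  (∀ i j, i ≠ j → Disjoint (A i) (A j)) ∧ univ.biUnion A = S

/-- The set of all items that are handed out by `A`. -/
def allocated (A : Fin n → Finset (Fin m)) : Finset (Fin m) := univ.biUnion A

/-- `max_{g ∈ S} v_i(S - {g})`, which is `0` if `S` is empty. -/
noncomputable def maxDrop (v : Fin n → Fin m → ℝ) (i : Fin n) (S : Finset (Fin m)) : ℝ :=
  if h : S.Nonempty then S.sup' h (fun g => value v i (S.erase g)) else 0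

/-- Envy-freeness up to any item. -/
def IsEFX (v : Fin n → Fin m → ℝ) (A : Fin n → Finset (Fin m)) : Prop :=
  ∀ i j, maxDrop v i (A j) ≤ value v i (A i)

/-- Nash welfare: the geometric mean of the agents' values. -/
noncomputable def nashWelfare (v : Fin n → Fin m → ℝ) (A : Fin n → Finset (Fin m)) : ℝ :=
  (∏ i, value v i (A i)) ^ (1 / (n : ℝ))

/-- The maximum Nash welfare over all allocations of `S`
(for `n ≥ 1` a supremum over a finite nonempty set). -/
noncomputable def opt (v : Fin n → Fin m → ℝ) (S : Finset (Fin m)) : ℝ :=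
  sSup {x : ℝ | ∃ A : Fin n → Finset (Fin m), IsAllocation S A ∧ x = nashWelfare v A}

/-- `A` is `α`-efficient with respect to the set of all items. -/
def IsEfficient (v : Fin n → Fin m → ℝ) (α : ℝ) (A : Fin n → Finset (Fin m)) : Prop :=
  opt v univ ≤ α * nashWelfare v A

/-- `A` is a Pareto-optimal allocation of the item set `S`. -/
def IsParetoOptimal (v : Fin n → Fin m → ℝ) (S : Finset (Fin m))
    (A : Fin n → Finset (Fin m)) : Prop :=
  IsAllocation S A ∧
    ¬ ∃ B : Fin n → Finset (Fin m), IsAllocation S B ∧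
      (∀ i, value v i (A i) ≤ value v i (B i)) ∧ ∃ i, value v i (A i) < value v i (B i)

end Allocations

/-! ### The item-removing algorithm

`X` is the initial allocation and `Z` the current family of bundles; the bundle vertices of the
EFX feasibility graph are named by their index `j`. All choices of the algorithm (which matching,
which unmatched agent, which robust demand, which least valued item) are left open. -/

section Algorithm

variable {n m : ℕ}

/-- The bundle `Z j` is EFX feasible for agent `i`. -/
def IsFeasible (v : Fin n → Fin m → ℝ) (Z : Fin n → Finset (Fin m)) (i j : Fin n) : Prop :=
  ∀ k, maxDrop v i (Z k) ≤ value v i (Z j)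

/-- The edge between agent `i` and bundle `Z j` of the EFX feasibility graph. -/
def IsEdge (v : Fin n → Fin m → ℝ) (Z : Fin n → Finset (Fin m)) (i j : Fin n) : Prop :=
  IsFeasible v Z i j ∧ (i ≠ j → value v i (Z i) < value v i (Z j))

/-- A matching of the EFX feasibility graph, as a set of pairs (agent, bundle index). -/
def IsMatching (v : Fin n → Fin m → ℝ) (Z : Fin n → Finset (Fin m))
    (M : Finset (Fin n × Fin n)) : Prop :=
  (∀ e ∈ M, IsEdge v Z e.1 e.2) ∧
    ∀ e ∈ M, ∀ e' ∈ M, (e.1 = e'.1 ∨ e.2 = e'.2) → e = e'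

/-- Condition (a): all touched bundles, i.e. those that miss an item, are matched. -/
def CoversTouched (X Z : Fin n → Finset (Fin m)) (M : Finset (Fin n × Fin n)) : Prop :=
  ∀ j, Z j ≠ X j → ∃ e ∈ M, e.2 = j

/-- The number of edges of `M` that match an agent to her own bundle. -/
def ownEdges (M : Finset (Fin n × Fin n)) : ℕ := (M.filter (fun e => e.1 = e.2)).card

/-- `M` is a matching that the algorithm may compute in a round: (a) it matches all touched
bundles; (b) under (a), `ownEdges M` is maximum; (c) under (a) and (b), its size is maximum. -/
def IsSelected (v : Fin n → Fin m → ℝ) (X Z : Fin n → Finset (Fin m))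
    (M : Finset (Fin n × Fin n)) : Prop :=
  (IsMatching v Z M ∧ CoversTouched X Z M) ∧
  (∀ M', IsMatching v Z M' → CoversTouched X Z M' → ownEdges M' ≤ ownEdges M) ∧
  (∀ M', IsMatching v Z M' → CoversTouched X Z M' → ownEdges M' = ownEdges M →
    M'.card ≤ M.card)

/-- Agent `i` is not matched in `M`. -/
def IsUnmatched (M : Finset (Fin n × Fin n)) (i : Fin n) : Prop := ∀ e ∈ M, e.1 ≠ i

/-- `Z j` is a robust demand of agent `i`. -/
def IsRobustDemand (v : Fin n → Fin m → ℝ) (Z : Fin n → Finset (Fin m)) (i j : Fin n) : Prop :=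
  ∀ k, maxDrop v i (Z k) ≤ maxDrop v i (Z j)

/-- A round of the algorithm that does not end it turns the bundles `Z` into `Z'`: for a selected
matching and some unmatched agent `i`, an item of least value for `i` is removed from a robust
demand of `i`. -/
def Round (v : Fin n → Fin m → ℝ) (X Z Z' : Fin n → Finset (Fin m)) : Prop :=
  ∃ (M : Finset (Fin n × Fin n)) (i j : Fin n) (c : Fin m),
    IsSelected v X Z M ∧ IsUnmatched M i ∧ IsRobustDemand v Z i j ∧
    c ∈ Z j ∧ (∀ g ∈ Z j, v i c ≤ v i g) ∧
    Z' = Function.update Z j ((Z j).erase c)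

/-- Started on `X`, the algorithm can hold the bundles `Z` after `k` item-removing rounds. -/
inductive Reaches (v : Fin n → Fin m → ℝ) (X : Fin n → Finset (Fin m)) :
    ℕ → (Fin n → Finset (Fin m)) → Prop
  | start : Reaches v X 0 X
  | next {k : ℕ} {Z Z' : Fin n → Finset (Fin m)} :
      Reaches v X k Z → Round v X Z Z' → Reaches v X (k + 1) Z'

/-- Started on `X`, the algorithm can stop and return `Y`: it has selected a matching that matches
all agents, and `Y` gives to each agent the bundle she is matched to. -/
def Returns (v : Fin n → Fin m → ℝ) (X Y : Fin n → Finset (Fin m)) : Prop :=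
  ∃ (k : ℕ) (Z : Fin n → Finset (Fin m)) (M : Finset (Fin n × Fin n)),
    Reaches v X k Z ∧ IsSelected v X Z M ∧ M.card = n ∧ ∀ e ∈ M, Y e.1 = Z e.2

/-- No run of the algorithm on `X` gets stuck or goes on for more than `m` item-removing rounds,
whatever choices it makes: a matching as required exists in every round, and if an agent is
unmatched, each of her robust demands contains an item to remove. -/
def AlwaysTerminates (v : Fin n → Fin m → ℝ) (X : Fin n → Finset (Fin m)) : Prop :=
  ∀ (k : ℕ) (Z : Fin n → Finset (Fin m)), Reaches v X k Z →
    k ≤ m ∧ (∃ M, IsSelected v X Z M) ∧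
    ∀ M, IsSelected v X Z M → M.card = n ∨
      ((∃ i, IsUnmatched M i) ∧ ∀ i, IsUnmatched M i →
        (∃ j, IsRobustDemand v Z i j) ∧ ∀ j, IsRobustDemand v Z i j → (Z j).Nonempty)

end Algorithm

/-! ### The machine model

A random access machine with two kinds of memory, one for natural numbers and one for real numbers,
each organised in tables that are addressed by two indices. Its operations are addition,
subtraction and comparison. There is no multiplication and the only real constant is `0`, so that
in `t` steps numbers grow by at most `O(t)` bits on rational inputs: the step count below is, up to
a polynomial, the running time of a Turing machine on rational inputs, and for real inputs it is
the number of arithmetic operations and comparisons. -/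

/-- The memory: `nat a i j` is the entry `(i, j)` of table `a` of natural numbers, and
`real a i j` that of table `a` of real numbers. -/
structure Memory where
  nat : ℕ → ℕ → ℕ → ℕ
  real : ℕ → ℕ → ℕ → ℝ

/-- Expressions of type natural number. -/
inductive NatExpr where
  | const (k : ℕ)
  | cell (a : ℕ) (i j : NatExpr)
  | add (x y : NatExpr)
  | sub (x y : NatExpr)

/-- Truncated subtraction is used for natural numbers. -/
def NatExpr.eval (s : Memory) : NatExpr → ℕ
  | const k => k
  | cell a i j => s.nat a (i.eval s) (j.eval s)
  | add x y => x.eval s + y.eval s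
  | sub x y => x.eval s - y.eval s

/-- The time to evaluate an expression is the number of its nodes. -/
def NatExpr.cost : NatExpr → ℕ
  | const _ => 1
  | cell _ i j => i.cost + j.cost + 1
  | add x y => x.cost + y.cost + 1
  | sub x y => x.cost + y.cost + 1

/-- Expressions of type real number. -/
inductive RealExpr where
  | zero
  | cell (a : ℕ) (i j : NatExpr)
  | add (x y : RealExpr)
  | sub (x y : RealExpr)

noncomputable def RealExpr.eval (s : Memory) : RealExpr → ℝ
  | zero => 0
  | cell a i j => s.real a (i.eval s) (j.eval s)
  | add x y => x.eval s + y.eval s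
  | sub x y => x.eval s - y.eval s

def RealExpr.cost : RealExpr → ℕ
  | zero => 1
  | cell _ i j => i.cost + j.cost + 1
  | add x y => x.cost + y.cost + 1
  | sub x y => x.cost + y.cost + 1

/-- Boolean tests. -/
inductive Test where
  | natLe (x y : NatExpr)
  | realLe (x y : RealExpr)
  | not (b : Test)
  | and (b c : Test)

def Test.Holds (s : Memory) : Test → Prop
  | natLe x y => x.eval s ≤ y.eval s
  | realLe x y => x.eval s ≤ y.eval s
  | not b => ¬ b.Holds s
  | and b c => b.Holds s ∧ c.Holds s

def Test.cost : Test → ℕ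
  | natLe x y => x.cost + y.cost + 1
  | realLe x y => x.cost + y.cost + 1
  | not b => b.cost + 1
  | and b c => b.cost + c.cost + 1

/-- Programs. -/
inductive Program where
  | skip
  | setNat (a : ℕ) (i j x : NatExpr)
  | setReal (a : ℕ) (i j : NatExpr) (x : RealExpr)
  | seq (p q : Program)
  | cond (b : Test) (p q : Program)
  | loop (b : Test) (p : Program)

/-- The memory after `x` has been written to entry `(i, j)` of table `a`. -/
def Memory.setNat (s : Memory) (a i j x : ℕ) : Memory where
  nat b k l := if b = a ∧ k = i ∧ l = j then x else s.nat b k l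
  real := s.real

noncomputable def Memory.setReal (s : Memory) (a i j : ℕ) (x : ℝ) : Memory where
  nat := s.nat
  real b k l := if b = a ∧ k = i ∧ l = j then x else s.real b k l

/-- `Runs p s t s'`: the program `p`, started on the memory `s`, halts after `t` steps and leaves
the memory `s'`. The program `loop b p` repeats `p` as long as `b` holds. -/
inductive Runs : Program → Memory → ℕ → Memory → Prop
  | skip (s : Memory) : Runs Program.skip s 1 s
  | setNat (a : ℕ) (i j x : NatExpr) (s : Memory) :
      Runs (Program.setNat a i j x) s (i.cost + j.cost + x.cost + 1)
        (s.setNat a (i.eval s) (j.eval s) (x.eval s))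
  | setReal (a : ℕ) (i j : NatExpr) (x : RealExpr) (s : Memory) :
      Runs (Program.setReal a i j x) s (i.cost + j.cost + x.cost + 1)
        (s.setReal a (i.eval s) (j.eval s) (x.eval s))
  | seq {p q : Program} {s s' s'' : Memory} {t t' : ℕ} :
      Runs p s t s' → Runs q s' t' s'' → Runs (Program.seq p q) s (t + t') s''
  | condTrue {b : Test} {p q : Program} {s s' : Memory} {t : ℕ} :
      b.Holds s → Runs p s t s' → Runs (Program.cond b p q) s (b.cost + t + 1) s'
  | condFalse {b : Test} {p q : Program} {s s' : Memory} {t : ℕ} :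
      ¬ b.Holds s → Runs q s t s' → Runs (Program.cond b p q) s (b.cost + t + 1) s'
  | loopStop {b : Test} {p : Program} {s : Memory} :
      ¬ b.Holds s → Runs (Program.loop b p) s (b.cost + 1) s
  | loopStep {b : Test} {p : Program} {s s' s'' : Memory} {t t' : ℕ} :
      b.Holds s → Runs p s t s' → Runs (Program.loop b p) s' t' s'' →
        Runs (Program.loop b p) s (b.cost + t + t' + 1) s''

/-- The memory that holds the input: `n` and `m` are the entries `(0, 0)` and `(0, 1)` of table `0`
of natural numbers, table `1` of natural numbers is the `0`-`1` incidence matrix of the allocation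
`X`, table `0` of real numbers is the matrix of the valuations, and all else is `0`. -/
noncomputable def inputMemory {n m : ℕ} (v : Fin n → Fin m → ℝ) (X : Fin n → Finset (Fin m)) :
    Memory where
  nat a i j :=
    if a = 0 ∧ i = 0 ∧ j = 0 then n
    else if a = 0 ∧ i = 0 ∧ j = 1 then m
    else if h : a = 1 ∧ i < n ∧ j < m then
      if (⟨j, h.2.2⟩ : Fin m) ∈ X ⟨i, h.2.1⟩ then 1 else 0
    else 0
  real a i j :=
    if h : a = 0 ∧ i < n ∧ j < m then v ⟨i, h.2.1⟩ ⟨j, h.2.2⟩ else 0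

/-- The output in the memory `s` is the allocation `Y`: table `2` of natural numbers holds its
incidence matrix. -/
def HoldsOutput {n m : ℕ} (s : Memory) (Y : Fin n → Finset (Fin m)) : Prop :=
  ∀ (i : Fin n) (g : Fin m), s.nat 2 i g = if g ∈ Y i then 1 else 0

/-- The algorithm can be implemented in polynomial time on the inputs `D`: one program, independent
of the input, halts on each input `(n, m, v, X)` in `D` within a number of steps that is polynomial
in `n + m`, with an output that the algorithm returns in one of its runs on `X`. -/
def RunsInPolynomialTime
    (D : ∀ n m : ℕ, (Fin n → Fin m → ℝ) → (Fin n → Finset (Fin m)) → Prop) : Prop :=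
  ∃ (P : Program) (p : Polynomial ℕ),
    ∀ (n m : ℕ) (v : Fin n → Fin m → ℝ) (X : Fin n → Finset (Fin m)), D n m v X →
      ∃ (t : ℕ) (s : Memory) (Y : Fin n → Finset (Fin m)),
        Runs P (inputMemory v X) t s ∧ t ≤ p.eval (n + m) ∧ HoldsOutput s Y ∧ Returns v X Y

/-- The admissible inputs: at least one agent, nonnegative valuations, and an allocation of all
items whose Nash welfare is maximum. -/
def IsInput (n m : ℕ) (v : Fin n → Fin m → ℝ) (X : Fin n → Finset (Fin m)) : Prop :=
  0 < n ∧ (∀ i g, 0 ≤ v i g) ∧ IsAllocation univ X ∧ nashWelfare v X = opt v univ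

end FairDivision

/-!
The argument has a combinatorial and an algorithmic part.

*Combinatorics.* An agent `i` who is unmatched in a selected matching does not find her own bundle
feasible (`IsSelected.not_isFeasible_self`), so the drop of a robust demand `Z j` exceeds her value.
Hence the item to be removed exists, `i ≠ j`, and what is left of `Z j` is feasible for `i`, who can
take it over in the matching (`IsSelected.exists_matching_after`). So a matching of all touched
bundles exists in every round. If the optimum is positive, every reallocation of `X` that favours
some agents at nobody's expense is excluded. Passing from `Z j` to the agent matched with it, to her
bundle, to the agent matched with that one, and so on, therefore leads to an untouched bundle, whose
owner could double her value in exchange if `j` had lost more than half of hers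
(`IsInput.half_value_of_mem_matching`). Together with an untouched bundle this gives the factor
`2 ^ (n - 1)` for the product of the values. As improvements of `X` are excluded, the final perfect
matching gives each agent her own bundle, and the result is Pareto-optimal.

*Algorithm.* A selected matching is a matching of maximum weight for suitable polynomially bounded
integral weights (`isSelected_of_weight`). It is computed by an auction: an agent without a bundle
takes a bundle of maximum surplus and raises its price by `1`. The final assignment is within `n` of
the optimum (`AuctionInv.exists_perm`), which is enough since the weights are multiples of `n + 1`.
Prices stay below the maximum weight plus `2`, so the number of bids is polynomial. The program is
verified with a predicate transformer `wp B` that also bounds the number of iterations of each loop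
by `B`; it implies a running time that is polynomial in `B` (`wp.runs`).
-/

namespace FairDivision

section Combinatorics

variable {n m : ℕ} {v : Fin n → Fin m → ℝ} {X Z : Fin n → Finset (Fin m)}

/-! ### Values and drops -/

lemma value_nonneg (hv : ∀ i g, 0 ≤ v i g) (i : Fin n) (S : Finset (Fin m)) :
    0 ≤ value v i S :=
  sum_nonneg fun g _ => hv i g

lemma value_mono (hv : ∀ i g, 0 ≤ v i g) (i : Fin n) {S T : Finset (Fin m)} (h : S ⊆ T) :
    value v i S ≤ value v i T :=
  sum_le_sum_of_subset_of_nonneg h fun g _ _ => hv i g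

lemma value_erase (i : Fin n) {S : Finset (Fin m)} {c : Fin m} (hc : c ∈ S) :
    value v i (S.erase c) = value v i S - v i c :=
  sum_erase_eq_sub hc

lemma value_erase_le_maxDrop (i : Fin n) {S : Finset (Fin m)} {c : Fin m} (hc : c ∈ S) :
    value v i (S.erase c) ≤ maxDrop v i S := by
  rw [maxDrop, dif_pos ⟨c, hc⟩]
  exact le_sup' (fun g => value v i (S.erase g)) hc

lemma maxDrop_le {i : Fin n} {S : Finset (Fin m)} {x : ℝ} (hx : 0 ≤ x)
    (h : ∀ g ∈ S, value v i (S.erase g) ≤ x) : maxDrop v i S ≤ x := by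
  rw [maxDrop]
  split
  · exact sup'_le _ _ h
  · exact hx

lemma maxDrop_nonneg (hv : ∀ i g, 0 ≤ v i g) (i : Fin n) (S : Finset (Fin m)) :
    0 ≤ maxDrop v i S := by
  rcases S.eq_empty_or_nonempty with rfl | ⟨c, hc⟩
  · simp [maxDrop]
  · exact (value_nonneg hv i _).trans (value_erase_le_maxDrop i hc)

lemma maxDrop_le_value (hv : ∀ i g, 0 ≤ v i g) (i : Fin n) (S : Finset (Fin m)) :
    maxDrop v i S ≤ value v i S :=
  maxDrop_le (value_nonneg hv i S) fun _ _ => value_mono hv i (erase_subset _ _)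

lemma maxDrop_mono (hv : ∀ i g, 0 ≤ v i g) (i : Fin n) {S T : Finset (Fin m)} (h : S ⊆ T) :
    maxDrop v i S ≤ maxDrop v i T :=
  maxDrop_le (maxDrop_nonneg hv i T) fun _ hg =>
    (value_mono hv i (erase_subset_erase _ h)).trans (value_erase_le_maxDrop i (h hg))

lemma maxDrop_eq_of_least {i : Fin n} {S : Finset (Fin m)} {c : Fin m} (hc : c ∈ S)
    (hmin : ∀ g ∈ S, v i c ≤ v i g) : maxDrop v i S = value v i (S.erase c) := by
  refine le_antisymm ?_ (value_erase_le_maxDrop i hc)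
  rw [maxDrop, dif_pos ⟨c, hc⟩]
  refine sup'_le _ _ fun g hg => ?_
  rw [value_erase i hg, value_erase i hc]
  linarith [hmin g hg]

/-! ### Allocations of maximum Nash welfare -/

lemma isAllocation_of_owner (o : Fin m → Fin n) :
    IsAllocation univ fun i => univ.filter fun g => o g = i := by
  refine ⟨fun i j hij => ?_, ?_⟩
  · rw [disjoint_left]
    intro g hi hj
    simp only [mem_filter, mem_univ, true_and] at hi hj
    exact hij (hi.symm.trans hj)
  · ext g
    simp

lemma IsAllocation.exists_owner (hX : IsAllocation univ X) :
    ∃ o : Fin m → Fin n, ∀ i g, g ∈ X i ↔ o g = i := by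
  have h : ∀ g, ∃ i, g ∈ X i := fun g => by
    have : g ∈ univ.biUnion X := by rw [hX.2]; exact mem_univ g
    simpa using this
  choose o ho using h
  refine ⟨o, fun i g => ⟨fun hg => ?_, fun h => h ▸ ho g⟩⟩
  by_contra hne
  exact disjoint_left.1 (hX.1 _ _ hne) (ho g) hg

lemma prod_value_nonneg (hv : ∀ i g, 0 ≤ v i g) (A : Fin n → Finset (Fin m)) :
    0 ≤ ∏ i, value v i (A i) :=
  prod_nonneg fun i _ => value_nonneg hv i _

lemma nashWelfare_nonneg (hv : ∀ i g, 0 ≤ v i g) (A : Fin n → Finset (Fin m)) :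
    0 ≤ nashWelfare v A :=
  Real.rpow_nonneg (prod_value_nonneg hv A) _

lemma nashWelfare_le_opt {S : Finset (Fin m)} {A : Fin n → Finset (Fin m)}
    (hA : IsAllocation S A) : nashWelfare v A ≤ opt v S := by
  refine le_csSup ?_ ⟨A, hA, rfl⟩
  refine ((Set.finite_range (nashWelfare v)).subset ?_).bddAbove
  rintro x ⟨B, -, rfl⟩
  exact ⟨B, rfl⟩

lemma IsInput.prod_le (h : IsInput n m v X) {A : Fin n → Finset (Fin m)}
    (hA : IsAllocation univ A) : ∏ i, value v i (A i) ≤ ∏ i, value v i (X i) := by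
  obtain ⟨hn, hv, -, hopt⟩ := h
  by_contra! hlt
  have h1 := nashWelfare_le_opt (v := v) hA
  rw [← hopt] at h1
  refine absurd h1 (not_le.2 ?_)
  exact Real.rpow_lt_rpow (prod_value_nonneg hv X) hlt (by positivity)

lemma IsInput.value_pos (h : IsInput n m v X) (hpos : 0 < opt v univ) (i : Fin n) :
    0 < value v i (X i) := by
  obtain ⟨hn, hv, -, hopt⟩ := h
  refine lt_of_le_of_ne (value_nonneg hv i _) fun h0 => ?_
  have : nashWelfare v X = 0 := by
    rw [nashWelfare, prod_eq_zero (mem_univ i) h0.symm]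
    exact Real.zero_rpow (by positivity)
  rw [← hopt, this] at hpos
  exact lt_irrefl _ hpos

/-- No allocation is a Pareto improvement of an allocation of maximum positive Nash welfare. -/
lemma IsInput.not_improvement (h : IsInput n m v X) (hpos : 0 < opt v univ)
    {W : Fin n → Finset (Fin m)} (hW : IsAllocation univ W)
    (hle : ∀ a, value v a (X a) ≤ value v a (W a)) {b : Fin n}
    (hlt : value v b (X b) < value v b (W b)) : False :=
  absurd (h.prod_le hW) (not_le.2 (prod_lt_prod (fun a _ => h.value_pos hpos a)
    (fun a _ => hle a) ⟨b, mem_univ b, hlt⟩))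

/-- In an allocation of maximum positive Nash welfare, one cannot double the value of some agent
at the expense of less than half of the value of another one. -/
lemma IsInput.not_double (h : IsInput n m v X) (hpos : 0 < opt v univ)
    {W : Fin n → Finset (Fin m)} (hW : IsAllocation univ W) {j e : Fin n} (hje : j ≠ e)
    (hle : ∀ a, a ≠ j → a ≠ e → value v a (X a) ≤ value v a (W a))
    (hj : value v j (X j) < 2 * value v j (W j))
    (he : 2 * value v e (X e) ≤ value v e (W e)) : False := by
  -- Compare with the values in `X` after rescaling them by factors of product `1`.
  let c : Fin n → ℝ := fun a => if a = j then 1 / 2 else if a = e then 2 else 1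
  have hc : ∏ a, c a = 1 := by
    have h1 : ∏ a, c a = ∏ a ∈ {j, e}, c a := by
      symm
      refine prod_subset (subset_univ _) fun a _ ha => ?_
      simp only [mem_insert, mem_singleton, not_or] at ha
      simp [c, ha.1, ha.2]
    rw [h1, prod_pair hje]
    simp [c, hje.symm]
  have hlt : ∏ a, c a * value v a (X a) < ∏ a, value v a (W a) := by
    refine prod_lt_prod (fun a _ => ?_) (fun a _ => ?_) ⟨j, mem_univ j, ?_⟩
    · refine mul_pos ?_ (h.value_pos hpos a)
      simp only [c]
      split_ifs <;> norm_num
    · simp only [c]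
      split_ifs with h1 h2
      · subst h1; linarith
      · subst h2; exact he
      · rw [one_mul]; exact hle a h1 h2
    · simp only [c, if_true]; linarith
  rw [prod_mul_distrib, hc, one_mul] at hlt
  exact absurd (h.prod_le hW) (not_le.2 hlt)

/-- If the bundles `Z b ⊆ X b` with `b ∈ T` are moved from their owners `b` to `f b`, then each
agent gains the bundles that she receives and loses her own one if it is moved. -/
lemma exists_reallocation (hX : IsAllocation univ X) (hZ : ∀ i, Z i ⊆ X i) (T : Finset (Fin n))
    (f : Fin n → Fin n) :
    ∃ W : Fin n → Finset (Fin m), IsAllocation univ W ∧ ∀ a, value v a (W a) =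
      value v a (X a) - (if a ∈ T then value v a (Z a) else 0)
        + ∑ b ∈ T with f b = a, value v a (Z b) := by
  obtain ⟨o, ho⟩ := hX.exists_owner
  refine ⟨_, isAllocation_of_owner fun g => if g ∈ Z (o g) ∧ o g ∈ T then f (o g) else o g,
    fun a => ?_⟩
  have key : ∀ S : Finset (Fin m), value v a S = ∑ g, if g ∈ S then v a g else 0 := fun S => by
    rw [value, sum_ite_mem, univ_inter]
  have hif : (if a ∈ T then value v a (Z a) else 0)
      = ∑ g, if a ∈ T then (if g ∈ Z a then v a g else 0) else 0 := by
    split_ifs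
    · exact key _
    · simp
  rw [hif]
  simp only [key]
  rw [sum_comm, ← sum_sub_distrib, ← sum_add_distrib]
  refine sum_congr rfl fun g _ => ?_
  have hoZ : ∀ b, g ∈ Z b → o g = b := fun b hb => (ho b g).1 (hZ b hb)
  simp only [mem_filter, mem_univ, true_and, ho]
  by_cases hg : g ∈ Z (o g) ∧ o g ∈ T
  · have hsum : ∑ b ∈ T with f b = a, (if g ∈ Z b then v a g else 0)
        = if f (o g) = a then v a g else 0 := by
      rw [sum_filter, sum_eq_single (o g)]
      · simp [hg.1]
      · intro b _ hb
        rw [if_neg fun h => hb (hoZ b h).symm]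
        simp
      · exact fun h => absurd hg.2 h
    rw [hsum, if_pos hg]
    by_cases ha : o g = a
    · subst ha
      simp [hg.1, hg.2]
    · have : g ∉ Z a := fun h => ha (hoZ a h)
      simp [ha, this]
  · rw [if_neg hg, sum_eq_zero]
    · have : (if a ∈ T then (if g ∈ Z a then v a g else 0) else 0) = 0 := by
        split_ifs with h1 h2
        · have := hoZ a h2
          subst this
          exact absurd ⟨h2, h1⟩ hg
        · rfl
        · rfl
      rw [this]; ring
    · intro b hb
      rw [if_neg]
      intro h2
      have := hoZ b h2
      subst this
      exact hg ⟨h2, (mem_filter.1 hb).1⟩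

/-! ### Matchings of the feasibility graph -/

/-- A matching that covers all touched bundles and contains a foreign edge `(i, j)`. The bundle `j`
wanders along the matching edges to `i`, the bundle of `i` to the agent matched with it, and so on.
This sequence ends in an unmatched, hence untouched bundle of an agent `e`, for otherwise it closes
to a cycle of strict gains. Then `e` can have her old bundle and the next one, which more than
doubles her value, at the expense of `j`, who keeps the removed items of hers. -/
lemma IsInput.half_value_of_mem_matching (h : IsInput n m v X) (hpos : 0 < opt v univ)
    (hZ : ∀ i, Z i ⊆ X i) {M : Finset (Fin n × Fin n)} (hM : IsMatching v Z M)
    (hcov : CoversTouched X Z M) {i j : Fin n} (hij : (i, j) ∈ M) (hne : i ≠ j) :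
    value v j (X j) ≤ 2 * value v j (Z j) ∧ ∃ e, Z e = X e := by
  classical
  have hv := h.2.1
  obtain ⟨f, hf⟩ : ∃ f : Fin n → Fin n, ∀ b, (∃ a, (a, b) ∈ M) → (f b, b) ∈ M := by
    refine ⟨fun b => if hb : ∃ a, (a, b) ∈ M then hb.choose else b, fun b hb => ?_⟩
    simp only [dif_pos hb]
    exact hb.choose_spec
  have hfj : f j = i :=
    congrArg Prod.fst (hM.2 _ (hf j ⟨i, hij⟩) _ hij (Or.inr rfl))
  have hgain : ∀ b, (∃ a, (a, b) ∈ M) → value v (f b) (Z (f b)) ≤ value v (f b) (Z b) := by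
    intro b hb
    by_cases hfb : f b = b
    · rw [hfb]
    · exact ((hM.1 _ (hf b hb)).2 hfb).le
  have hterm : ∀ T : Finset (Fin n), ∀ a, ∀ b ∈ T, f b = a →
      value v a (Z b) ≤ ∑ b ∈ T with f b = a, value v a (Z b) := fun T a b hb hfb =>
    single_le_sum (f := fun b => value v a (Z b)) (fun b _ => value_nonneg hv a _)
      (mem_filter.2 ⟨hb, hfb⟩)
  by_cases hend : ∃ s, ¬ ∃ a, (a, f^[s] j) ∈ M
  -- The sequence `f^[s] j` first meets an unmatched bundle `e` at `s = k`; those before it move.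
  · have hk := Nat.find_spec hend
    have hlt : ∀ s < Nat.find hend, ∃ a, (a, f^[s] j) ∈ M := fun s hs =>
      not_not.1 (Nat.find_min hend hs)
    set k := Nat.find hend with hkdef
    set e := f^[k] j with he
    have huntouched : Z e = X e := by
      by_contra hne'
      obtain ⟨p, hp, hpe⟩ := hcov e hne'
      exact hk ⟨p.1, by rw [← hpe]; exact hp⟩
    refine ⟨?_, e, huntouched⟩
    have hk0 : k ≠ 0 := by
      intro h0
      apply hk
      rw [he, h0]
      exact ⟨i, hij⟩
    obtain ⟨k', hk'⟩ := Nat.exists_eq_succ_of_ne_zero hk0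
    let T := (range k).image fun s => f^[s] j
    have hTM : ∀ b ∈ T, ∃ a, (a, b) ∈ M := by
      intro b hb
      obtain ⟨s, hs, rfl⟩ := mem_image.1 hb
      exact hlt s (mem_range.1 hs)
    have heT : e ∉ T := fun heT => hk (hTM e heT)
    have hjT : j ∈ T := mem_image.2 ⟨0, mem_range.2 (by omega), rfl⟩
    obtain ⟨W, hW, hval⟩ := exists_reallocation (v := v) h.2.2.1 hZ T f
    by_contra! hhalf
    have hWle : ∀ a, a ≠ j → value v a (X a) ≤ value v a (W a) := by
      intro a ha
      rw [hval a]
      by_cases haT : a ∈ T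
      · obtain ⟨s, hs, rfl⟩ := mem_image.1 haT
        rw [if_pos haT]
        cases s with
        | zero => exact absurd rfl ha
        | succ s =>
          have hsT : f^[s] j ∈ T :=
            mem_image.2 ⟨s, mem_range.2 (by have := mem_range.1 hs; omega), rfl⟩
          have h1 := hterm T (f^[s + 1] j) _ hsT (Function.iterate_succ_apply' f s j).symm
          have h2 := hgain _ (hTM _ hsT)
          rw [← Function.iterate_succ_apply' f s j] at h2
          linarith
      · rw [if_neg haT]
        have : 0 ≤ ∑ b ∈ T with f b = a, value v a (Z b) :=
          sum_nonneg fun b _ => value_nonneg hv a _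
        linarith
    refine h.not_double hpos hW (j := j) (e := e) (fun hje => heT (hje ▸ hjT))
      (fun a ha _ => hWle a ha) ?_ ?_
    · rw [hval j, if_pos hjT]
      have : 0 ≤ ∑ b ∈ T with f b = j, value v j (Z b) :=
        sum_nonneg fun b _ => value_nonneg hv j _
      linarith
    · have hsT : f^[k'] j ∈ T := mem_image.2 ⟨k', mem_range.2 (by omega), rfl⟩
      have hfe : f (f^[k'] j) = e := by
        rw [he, hk', Nat.succ_eq_add_one, Function.iterate_succ_apply']
      have h1 := hterm T e _ hsT hfe
      have h2 := hgain _ (hTM _ hsT)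
      rw [hfe, huntouched] at h2
      rw [hval e, if_neg heT]
      linarith
  -- Otherwise the matching permutes the orbit of `j`, and everybody on it gains, `i` strictly.
  · exfalso
    push Not at hend
    let T := univ.filter fun a => ∃ s, f^[s] j = a
    have hmem : ∀ a, a ∈ T ↔ ∃ s, f^[s] j = a := fun a => by simp [T]
    have hTM : ∀ b ∈ T, ∃ a, (a, b) ∈ M := by
      intro b hb
      obtain ⟨s, rfl⟩ := (hmem b).1 hb
      exact hend s
    have hmaps : ∀ b ∈ T, f b ∈ T := by
      intro b hb
      obtain ⟨s, rfl⟩ := (hmem b).1 hb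
      exact (hmem _).2 ⟨s + 1, Function.iterate_succ_apply' f s j⟩
    have hinj : ∀ b ∈ T, ∀ b' ∈ T, f b = f b' → b = b' := by
      intro b hb b' hb' hbb
      exact congrArg Prod.snd
        (hM.2 _ (hf b (hTM b hb)) _ (hf b' (hTM b' hb')) (Or.inl hbb))
    have himg : T.image f = T :=
      eq_of_subset_of_card_le (image_subset_iff.2 hmaps)
        (card_image_of_injOn fun b hb b' hb' => hinj b hb b' hb').ge
    have hjT : j ∈ T := (hmem j).2 ⟨0, rfl⟩
    obtain ⟨W, hW, hval⟩ := exists_reallocation (v := v) h.2.2.1 hZ T f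
    refine h.not_improvement hpos hW (b := i) (fun a => ?_) ?_
    · rw [hval a]
      by_cases haT : a ∈ T
      · obtain ⟨b, hb, hba⟩ := mem_image.1 (himg.symm ▸ haT)
        have h1 := hterm T a b hb hba
        have h2 := hgain b (hTM b hb)
        rw [hba] at h2
        rw [if_pos haT]
        linarith
      · rw [if_neg haT]
        have : 0 ≤ ∑ b ∈ T with f b = a, value v a (Z b) :=
          sum_nonneg fun b _ => value_nonneg hv a _
        linarith
    · rw [hval i, if_pos (hfj ▸ hmaps j hjT)]
      have h1 := hterm T i j hjT hfj
      have h2 := (hM.1 _ hij).2 hne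
      simp only at h2
      linarith

lemma IsMatching.exists_perm {M : Finset (Fin n × Fin n)} (hM : IsMatching v Z M)
    (hcard : M.card = n) : ∃ σ : Equiv.Perm (Fin n), ∀ i, (i, σ i) ∈ M := by
  have h1 : M.image Prod.fst = univ := by
    rw [← card_eq_iff_eq_univ, card_image_of_injOn, hcard, Fintype.card_fin]
    exact fun e he e' he' hee => hM.2 e he e' he' (Or.inl hee)
  have h2 : ∀ i, ∃ b, (i, b) ∈ M := fun i => by
    have : i ∈ M.image Prod.fst := by rw [h1]; exact mem_univ i
    obtain ⟨⟨a, b⟩, hab, rfl⟩ := mem_image.1 this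
    exact ⟨b, hab⟩
  choose σ hσ using h2
  have hinj : Function.Injective σ := fun i i' hii =>
    congrArg Prod.fst (hM.2 _ (hσ i) _ (hσ i') (Or.inr hii))
  exact ⟨Equiv.ofBijective σ (Finite.injective_iff_bijective.1 hinj), hσ⟩

/-- For an input of positive Nash welfare, a perfect matching of the feasibility graph gives each
agent her own bundle: otherwise handing over the bundles along the matching is an improvement. -/
lemma IsInput.perm_eq_one (h : IsInput n m v X) (hpos : 0 < opt v univ) (hZ : ∀ i, Z i ⊆ X i)
    {σ : Equiv.Perm (Fin n)} (hσ : ∀ i, IsEdge v Z i (σ i)) : σ = 1 := by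
  by_contra hne
  obtain ⟨W, hW, hval⟩ := exists_reallocation (v := v) h.2.2.1 hZ univ σ.symm
  have hval' : ∀ a, value v a (W a)
      = value v a (X a) - value v a (Z a) + value v a (Z (σ a)) := fun a => by
    have : univ.filter (fun b => σ.symm b = a) = {σ a} := by
      ext b
      simp [Equiv.symm_apply_eq]
    rw [hval a, this]
    simp
  obtain ⟨b, hb⟩ : ∃ b, σ b ≠ b := by
    by_contra! hall
    exact hne (Equiv.ext hall)
  refine h.not_improvement hpos hW (b := b) (fun a => ?_) ?_
  · rw [hval' a]
    by_cases ha : a = σ a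
    · rw [← ha]; linarith
    · linarith [(hσ a).2 ha]
  · rw [hval' b]
    linarith [(hσ b).2 (Ne.symm hb)]

/-- An agent who is unmatched in a selected matching does not find her own bundle feasible:
otherwise she could take it, possibly from another agent, which gives one more own edge. -/
lemma IsSelected.not_isFeasible_self {M : Finset (Fin n × Fin n)} (hM : IsSelected v X Z M)
    {i : Fin n} (hi : IsUnmatched M i) : ¬ IsFeasible v Z i i := by
  intro hfeas
  let M' := insert (i, i) (M.filter fun e => e.2 ≠ i)
  have hM' : IsMatching v Z M' := by
    refine ⟨fun e he => ?_, fun e he e' he' hee => ?_⟩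
    · rcases mem_insert.1 he with rfl | he
      · exact ⟨hfeas, fun h => absurd rfl h⟩
      · exact hM.1.1.1 e (mem_filter.1 he).1
    · rcases mem_insert.1 he with rfl | he <;> rcases mem_insert.1 he' with rfl | he'
      · rfl
      · obtain ⟨h1, h2⟩ := mem_filter.1 he'
        rcases hee with h | h
        · exact absurd h.symm (hi _ h1)
        · exact absurd h.symm h2
      · obtain ⟨h1, h2⟩ := mem_filter.1 he
        rcases hee with h | h
        · exact absurd h (hi _ h1)
        · exact absurd h h2
      · exact hM.1.1.2 e (mem_filter.1 he).1 e' (mem_filter.1 he').1 hee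
  have hcov : CoversTouched X Z M' := by
    intro b hb
    by_cases hbi : b = i
    · exact ⟨(i, i), mem_insert_self _ _, hbi.symm⟩
    · obtain ⟨e, he, rfl⟩ := hM.1.2 b hb
      exact ⟨e, mem_insert_of_mem (mem_filter.2 ⟨he, hbi⟩), rfl⟩
  have hown : ownEdges M' = ownEdges M + 1 := by
    have : M'.filter (fun e => e.1 = e.2) = insert (i, i) (M.filter fun e => e.1 = e.2) := by
      ext e
      simp only [M', mem_filter, mem_insert]
      constructor
      · rintro ⟨rfl | ⟨h1, -⟩, h3⟩
        · exact Or.inl rfl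
        · exact Or.inr ⟨h1, h3⟩
      · rintro (rfl | ⟨h1, h3⟩)
        · exact ⟨Or.inl rfl, rfl⟩
        · exact ⟨Or.inr ⟨h1, fun h => hi e h1 (h3.trans h)⟩, h3⟩
    rw [ownEdges, this, card_insert_of_notMem, ownEdges]
    exact fun h => hi _ (mem_filter.1 h).1 rfl
  have := hM.2.1 M' hM' hcov
  omega

lemma IsSelected.lt_maxDrop {M : Finset (Fin n × Fin n)} (hM : IsSelected v X Z M)
    {i j : Fin n} (hi : IsUnmatched M i) (hj : IsRobustDemand v Z i j) :
    value v i (Z i) < maxDrop v i (Z j) := by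
  have := hM.not_isFeasible_self hi
  rw [IsFeasible] at this
  push Not at this
  obtain ⟨k, hk⟩ := this
  exact hk.trans_le (hj k)

lemma IsSelected.robustDemand_nonempty (hv : ∀ i g, 0 ≤ v i g) {M : Finset (Fin n × Fin n)}
    (hM : IsSelected v X Z M) {i j : Fin n} (hi : IsUnmatched M i)
    (hj : IsRobustDemand v Z i j) : (Z j).Nonempty := by
  by_contra hempty
  have h1 := hM.lt_maxDrop hi hj
  rw [maxDrop, dif_neg hempty] at h1
  exact absurd h1 (not_lt.2 (value_nonneg hv i _))

lemma update_erase_subset (j : Fin n) (c : Fin m) (b : Fin n) :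
    Function.update Z j ((Z j).erase c) b ⊆ Z b := by
  by_cases hb : b = j
  · subst hb
    simp [erase_subset]
  · simp [hb]

/-- After an item has been removed from the robust demand of the unmatched agent `i`, this bundle
is feasible for `i`, so she can replace the agent who was matched with it. -/
lemma IsSelected.exists_matching_after (hv : ∀ i g, 0 ≤ v i g)
    {M : Finset (Fin n × Fin n)} (hM : IsSelected v X Z M) {i j : Fin n} {c : Fin m}
    (hi : IsUnmatched M i) (hj : IsRobustDemand v Z i j) (hc : c ∈ Z j)
    (hmin : ∀ g ∈ Z j, v i c ≤ v i g) :
    i ≠ j ∧ ∃ M', (i, j) ∈ M' ∧ IsMatching v (Function.update Z j ((Z j).erase c)) M' ∧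
      CoversTouched X (Function.update Z j ((Z j).erase c)) M' := by
  have hlt := hM.lt_maxDrop hi hj
  have hne : i ≠ j := by
    rintro rfl
    exact absurd hlt (not_lt.2 (maxDrop_le_value hv i _))
  set Z' := Function.update Z j ((Z j).erase c) with hZ'
  have hsub : ∀ b, Z' b ⊆ Z b := fun b => update_erase_subset j c b
  have hZj : Z' j = (Z j).erase c := Function.update_self ..
  have hZne : ∀ b, b ≠ j → Z' b = Z b := fun b hb => Function.update_of_ne hb ..
  have hdrop := maxDrop_eq_of_least hc hmin
  refine ⟨hne, insert (i, j) (M.filter fun e => e.2 ≠ j), mem_insert_self _ _,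
    ⟨fun e he => ?_, fun e he e' he' hee => ?_⟩, fun b hb => ?_⟩
  · rcases mem_insert.1 he with rfl | he
    · refine ⟨fun k => ?_, fun _ => ?_⟩
      · simp only
        rw [hZj, ← hdrop]
        exact (maxDrop_mono hv i (hsub k)).trans (hj k)
      · simp only
        rw [hZj, hZne i hne, ← hdrop]
        exact hlt
    · obtain ⟨heM, hej⟩ := mem_filter.1 he
      have hedge := hM.1.1.1 e heM
      refine ⟨fun k => ?_, fun hee => ?_⟩
      · rw [hZne _ hej]
        exact (maxDrop_mono hv e.1 (hsub k)).trans (hedge.1 k)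
      · rw [hZne _ hej]
        exact (value_mono hv e.1 (hsub _)).trans_lt (hedge.2 hee)
  · rcases mem_insert.1 he with rfl | he <;> rcases mem_insert.1 he' with rfl | he'
    · rfl
    · obtain ⟨h1, h2⟩ := mem_filter.1 he'
      rcases hee with h | h
      · exact absurd h.symm (hi _ h1)
      · exact absurd h.symm h2
    · obtain ⟨h1, h2⟩ := mem_filter.1 he
      rcases hee with h | h
      · exact absurd h (hi _ h1)
      · exact absurd h h2
    · exact hM.1.1.2 e (mem_filter.1 he).1 e' (mem_filter.1 he').1 hee
  · by_cases hbj : b = j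
    · exact ⟨(i, j), mem_insert_self _ _, hbj.symm⟩
    · rw [hZne b hbj] at hb
      obtain ⟨e, he, rfl⟩ := hM.1.2 b hb
      exact ⟨e, mem_insert_of_mem (mem_filter.2 ⟨he, hbj⟩), rfl⟩

/-! ### Invariants of the algorithm -/

lemma Reaches.subset {k : ℕ} (h : Reaches v X k Z) : ∀ i, Z i ⊆ X i := by
  induction h with
  | start => exact fun i => Subset.rfl
  | next _ hr ih =>
    obtain ⟨M, i, j, c, -, -, -, -, -, rfl⟩ := hr
    exact fun b => (update_erase_subset j c b).trans (ih b)

lemma Reaches.exists_matching (hv : ∀ i g, 0 ≤ v i g) {k : ℕ} (h : Reaches v X k Z) :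
    ∃ M, IsMatching v Z M ∧ CoversTouched X Z M := by
  cases h with
  | start => exact ⟨∅, ⟨by simp, by simp⟩, fun j hj => absurd rfl hj⟩
  | next hr hround =>
    obtain ⟨M, i, j, c, hM, hi, hj, hc, hmin, rfl⟩ := hround
    obtain ⟨-, M', -, h1, h2⟩ := hM.exists_matching_after hv hi hj hc hmin
    exact ⟨M', h1, h2⟩

lemma Reaches.half_value (hin : IsInput n m v X) (hpos : 0 < opt v univ) {k : ℕ}
    (h : Reaches v X k Z) :
    (∀ i, value v i (X i) ≤ 2 * value v i (Z i)) ∧ ∃ e, Z e = X e := by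
  induction h with
  | start =>
    exact ⟨fun i => by linarith [value_nonneg hin.2.1 i (X i)], ⟨0, hin.1⟩, rfl⟩
  | next hr hround ih =>
    have hsub := (Reaches.next hr hround).subset
    obtain ⟨M, i, j, c, hM, hi, hj, hc, hmin, rfl⟩ := hround
    obtain ⟨hne, M', hmem, h1, h2⟩ := hM.exists_matching_after hin.2.1 hi hj hc hmin
    have hkey := hin.half_value_of_mem_matching hpos hsub h1 h2 hmem hne
    refine ⟨fun b => ?_, hkey.2⟩
    by_cases hb : b = j
    · subst hb; exact hkey.1
    · rw [Function.update_of_ne hb]; exact ih.1 b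

lemma Reaches.sum_card (hX : IsAllocation univ X) {k : ℕ} (h : Reaches v X k Z) :
    k + ∑ i, (Z i).card = m := by
  induction h with
  | start =>
    rw [zero_add, ← card_biUnion fun i _ j _ hij => hX.1 i j hij, hX.2, card_univ,
      Fintype.card_fin]
  | @next k Z Z' hr hround ih =>
    obtain ⟨M, i, j, c, -, -, -, hc, -, rfl⟩ := hround
    have h1 := add_sum_erase univ (fun b => (Z b).card) (mem_univ j)
    have h2 := add_sum_erase univ
      (fun b => (Function.update Z j ((Z j).erase c) b).card) (mem_univ j)
    have h3 : ∑ b ∈ univ.erase j, (Function.update Z j ((Z j).erase c) b).card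
        = ∑ b ∈ univ.erase j, (Z b).card :=
      sum_congr rfl fun b hb => by rw [Function.update_of_ne (mem_erase.1 hb).1]
    have h4 := card_erase_add_one hc
    simp only [Function.update_self] at h2
    omega

lemma exists_robustDemand (hn : 0 < n) (i : Fin n) : ∃ j, IsRobustDemand v Z i j := by
  have : Nonempty (Fin n) := ⟨⟨0, hn⟩⟩
  exact Finite.exists_max fun j => maxDrop v i (Z j)

lemma exists_isSelected (h : ∃ M, IsMatching v Z M ∧ CoversTouched X Z M) :
    ∃ M, IsSelected v X Z M := by
  classical
  let S := univ.filter fun M => IsMatching v Z M ∧ CoversTouched X Z M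
  have hS : ∀ M, M ∈ S ↔ IsMatching v Z M ∧ CoversTouched X Z M := fun M => by simp [S]
  have hne : S.Nonempty := h.imp fun M hM => (hS M).2 hM
  obtain ⟨M₁, h₁, hmax₁⟩ := exists_max_image S ownEdges hne
  obtain ⟨M₂, h₂, hmax₂⟩ := exists_max_image (S.filter fun M => ownEdges M = ownEdges M₁) card
    ⟨M₁, mem_filter.2 ⟨h₁, rfl⟩⟩
  obtain ⟨h₂S, h₂o⟩ := mem_filter.1 h₂
  exact ⟨M₂, (hS _).1 h₂S, fun M' h1 h2 => h₂o ▸ hmax₁ M' ((hS _).2 ⟨h1, h2⟩),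
    fun M' h1 h2 h3 => hmax₂ M' (mem_filter.2 ⟨(hS _).2 ⟨h1, h2⟩, h3.trans h₂o⟩)⟩

lemma IsMatching.card_eq_or_exists_isUnmatched {M : Finset (Fin n × Fin n)}
    (hM : IsMatching v Z M) : M.card = n ∨ ∃ i, IsUnmatched M i := by
  by_contra! hcon
  obtain ⟨hne, hall⟩ := hcon
  apply hne
  have h1 : M.image Prod.fst = univ := by
    ext i
    have := hall i
    simp only [IsUnmatched, not_forall, not_not] at this
    obtain ⟨e, he, hei⟩ := this
    simp only [mem_univ, iff_true]
    exact mem_image.2 ⟨e, he, hei⟩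
  rw [← card_image_of_injOn (s := M) (f := Prod.fst)
    fun e he e' he' hee => hM.2 e he e' he' (Or.inl hee), h1, card_univ, Fintype.card_fin]

lemma IsInput.alwaysTerminates (h : IsInput n m v X) : AlwaysTerminates v X := by
  intro k Z hr
  refine ⟨?_, exists_isSelected (hr.exists_matching h.2.1), fun M hM => ?_⟩
  · have := hr.sum_card h.2.2.1
    omega
  · refine hM.1.1.card_eq_or_exists_isUnmatched.imp_right fun hi => ⟨hi, fun i hi => ?_⟩
    exact ⟨exists_robustDemand h.1 i, fun j hj => hM.robustDemand_nonempty h.2.1 hi hj⟩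

/-! ### The returned allocation -/

/-- If there are fewer items than agents and all values are positive, then a perfect matching can
exist only when no bundle has two items; then each agent finds her own bundle feasible. -/
lemma isFeasible_self_of_card_lt (hv : ∀ i g, 0 < v i g) (hX : IsAllocation univ X)
    (hZ : ∀ i, Z i ⊆ X i) (hmn : m < n) {σ : Equiv.Perm (Fin n)}
    (hσ : ∀ i, IsFeasible v Z i (σ i)) (i : Fin n) : IsFeasible v Z i i := by
  have hv0 : ∀ i g, 0 ≤ v i g := fun i g => (hv i g).le
  suffices hdrop : ∀ k, maxDrop v i (Z k) = 0 from fun k =>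
    (hdrop k).trans_le (value_nonneg hv0 i _)
  intro k
  by_contra hne
  -- A bundle with two items forces each matched bundle to be nonempty, so `n ≤ m`.
  have hex : ∃ g ∈ Z k, ((Z k).erase g).Nonempty := by
    by_contra! hall
    refine hne (le_antisymm (maxDrop_le le_rfl fun g hg => ?_) (maxDrop_nonneg hv0 i _))
    rw [hall g hg]
    simp [value]
  obtain ⟨g, hg, hg2⟩ := hex
  have hnonempty : ∀ b, (Z b).Nonempty := by
    intro b
    by_contra hb
    have h1 := hσ (σ.symm b) k
    rw [Equiv.apply_symm_apply, not_nonempty_iff_eq_empty.1 hb] at h1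
    have h2 : 0 < value v (σ.symm b) ((Z k).erase g) := sum_pos (fun g _ => hv _ g) hg2
    have h3 := value_erase_le_maxDrop (v := v) (σ.symm b) hg
    simp only [value, sum_empty] at h1
    rw [value] at h2 h3
    linarith
  have h1 : ∑ b, (X b).card = m := by
    rw [← card_biUnion fun i _ j _ hij => hX.1 i j hij, hX.2, card_univ, Fintype.card_fin]
  have h2 : ∑ _b : Fin n, 1 ≤ ∑ b, (X b).card :=
    sum_le_sum fun b _ => card_pos.2 ((hnonempty b).mono (hZ b))
  simp at h2
  omega

lemma opt_pos_of_le (hn : 0 < n) (hv : ∀ i g, 0 < v i g) (hnm : n ≤ m) : 0 < opt v univ := by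
  let o : Fin m → Fin n := fun g => if h : g.1 < n then ⟨g.1, h⟩ else ⟨0, hn⟩
  refine lt_of_lt_of_le ?_ (nashWelfare_le_opt (isAllocation_of_owner o))
  refine Real.rpow_pos_of_pos (prod_pos fun i _ => sum_pos (fun g _ => hv i g) ?_) _
  exact ⟨⟨i.1, i.2.trans_le hnm⟩, by simp [o]⟩

/-- A selected perfect matching leaves the bundles with their owners if the optimum or all values are
positive. If the optimum is `0` and all values are positive, there are fewer items than agents. -/
lemma IsSelected.perm_eq_one {M : Finset (Fin n × Fin n)} (h : IsInput n m v X)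
    (hcond : 0 < opt v univ ∨ ∀ i g, 0 < v i g) (hZ : ∀ i, Z i ⊆ X i)
    (hM : IsSelected v X Z M) {σ : Equiv.Perm (Fin n)}
    (hσ : ∀ i, (i, σ i) ∈ M) : σ = 1 := by
  by_cases hpos : 0 < opt v univ
  · exact h.perm_eq_one hpos hZ fun i => hM.1.1.1 _ (hσ i)
  have hv := hcond.resolve_left hpos
  have hmn : m < n := by
    by_contra! hnm
    exact hpos (opt_pos_of_le h.1 hv hnm)
  have hfeas := isFeasible_self_of_card_lt hv h.2.2.1 hZ hmn
    fun i => (hM.1.1.1 _ (hσ i)).1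
  -- The own edges form a perfect matching, so by the choice of `M` all its edges are own edges.
  let D : Finset (Fin n × Fin n) := univ.image fun i => (i, i)
  have hD : IsMatching v Z D := by
    refine ⟨fun e he => ?_, fun e he e' he' hee => ?_⟩
    · obtain ⟨i, -, rfl⟩ := mem_image.1 he
      exact ⟨hfeas i, fun h => absurd rfl h⟩
    · obtain ⟨i, -, rfl⟩ := mem_image.1 he
      obtain ⟨i', -, rfl⟩ := mem_image.1 he'
      rcases hee with h | h <;> simp only at h <;> rw [h]
  have hown := hM.2.1 D hD fun j _ => ⟨(j, j), mem_image.2 ⟨j, mem_univ j, rfl⟩, rfl⟩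
  have hDown : ownEdges D = n := by
    have : D.filter (fun e => e.1 = e.2) = D := by
      refine filter_true_of_mem fun e he => ?_
      obtain ⟨i, -, rfl⟩ := mem_image.1 he
      rfl
    rw [ownEdges, this, card_image_of_injective _ fun i j hij => congrArg Prod.fst hij, card_univ,
      Fintype.card_fin]
  have himg : (M.filter fun e => e.1 = e.2).image Prod.fst = univ := by
    rw [← card_eq_iff_eq_univ, Fintype.card_fin]
    refine le_antisymm (by simpa using card_le_univ ((M.filter fun e => e.1 = e.2).image Prod.fst))
      ?_
    rw [card_image_of_injOn]
    · rw [hDown] at hown; exact hown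
    · exact fun e he e' he' hee =>
        hM.1.1.2 e (mem_filter.1 he).1 e' (mem_filter.1 he').1 (Or.inl hee)
  ext i
  have : i ∈ (M.filter fun e => e.1 = e.2).image Prod.fst := by rw [himg]; exact mem_univ i
  obtain ⟨e, he, hei⟩ := mem_image.1 this
  obtain ⟨he1, he2⟩ := mem_filter.1 he
  have := hM.1.1.2 e he1 _ (hσ i) (Or.inl hei)
  subst this
  simp only at he2
  simp [← he2]

lemma IsInput.paretoOptimal (h : IsInput n m v X) (hpos : 0 < opt v univ)
    (hZ : ∀ i, Z i ⊆ X i) (hA : IsAllocation (allocated Z) Z) :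
    IsParetoOptimal v (allocated Z) Z := by
  refine ⟨hA, ?_⟩
  rintro ⟨B, hB, hle, b, hlt⟩
  have hBZ : ∀ {i g}, g ∈ B i → ∃ k, g ∈ Z k := fun {i g} hg => by
    have : g ∈ univ.biUnion B := mem_biUnion.2 ⟨i, mem_univ i, hg⟩
    rw [hB.2, allocated] at this
    simpa using this
  have hdis : ∀ {i j g}, g ∈ B i → g ∈ X j → g ∈ Z j := fun {i j g} h1 h2 => by
    obtain ⟨k, hk⟩ := hBZ h1
    by_contra hne
    have hkj : k ≠ j := fun hkj => hne (hkj ▸ hk)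
    exact disjoint_left.1 (h.2.2.1.1 k j hkj) (hZ k hk) h2
  let W : Fin n → Finset (Fin m) := fun i => B i ∪ (X i \ Z i)
  have hW : IsAllocation univ W := by
    refine ⟨fun i j hij => disjoint_left.2 fun g hi hj => ?_, eq_univ_iff_forall.2 fun g => ?_⟩
    · simp only [W, mem_union, mem_sdiff] at hi hj
      rcases hi with hi | hi <;> rcases hj with hj | hj
      · exact disjoint_left.1 (hB.1 i j hij) hi hj
      · exact hj.2 (hdis hi hj.1)
      · exact hi.2 (hdis hj hi.1)
      · exact disjoint_left.1 (h.2.2.1.1 i j hij) hi.1 hj.1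
    · obtain ⟨o, ho⟩ := h.2.2.1.exists_owner
      by_cases hg : g ∈ Z (o g)
      · have : g ∈ univ.biUnion B := by
          rw [hB.2]
          exact mem_biUnion.2 ⟨_, mem_univ _, hg⟩
        obtain ⟨i, -, hi⟩ := mem_biUnion.1 this
        exact mem_biUnion.2 ⟨i, mem_univ i, mem_union_left _ hi⟩
      · exact mem_biUnion.2 ⟨o g, mem_univ _,
          mem_union_right _ (mem_sdiff.2 ⟨(ho _ g).2 rfl, hg⟩)⟩
  have hval : ∀ i, value v i (W i)
      = value v i (B i) + (value v i (X i) - value v i (Z i)) := fun i => by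
    have hd : Disjoint (B i) (X i \ Z i) :=
      disjoint_left.2 fun g h1 h2 => (mem_sdiff.1 h2).2 (hdis h1 (mem_sdiff.1 h2).1)
    have h2 : value v i (X i \ Z i) + value v i (Z i) = value v i (X i) :=
      sum_sdiff (hZ i)
    have h1 : value v i (W i) = value v i (B i) + value v i (X i \ Z i) := sum_union hd
    linarith
  exact h.not_improvement hpos hW (b := b) (fun a => by rw [hval a]; linarith [hle a])
    (by rw [hval b]; linarith)

lemma IsInput.isEfficient (h : IsInput n m v X) {Y : Fin n → Finset (Fin m)}
    (hhalf : ∀ i, value v i (X i) ≤ 2 * value v i (Y i)) {e : Fin n} (he : Y e = X e) :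
    IsEfficient v ((2 : ℝ) ^ (1 - 1 / (n : ℝ))) Y := by
  obtain ⟨hn, hv, -, hopt⟩ := h
  have hn' : (0 : ℝ) < n := by exact_mod_cast hn
  have hprod : ∏ i, value v i (X i) ≤ (2 : ℝ) ^ ((n : ℝ) - 1) * ∏ i, value v i (Y i) := by
    have h1 : ∏ i ∈ univ.erase e, value v i (X i)
        ≤ ∏ i ∈ univ.erase e, (2 * value v i (Y i)) :=
      prod_le_prod (fun i _ => value_nonneg hv i _) fun i _ => hhalf i
    rw [prod_mul_distrib, prod_const, card_erase_of_mem (mem_univ e), card_univ,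
      Fintype.card_fin] at h1
    rw [← mul_prod_erase univ (fun i => value v i (X i)) (mem_univ e),
      ← mul_prod_erase univ (fun i => value v i (Y i)) (mem_univ e), he]
    have h2 : (2 : ℝ) ^ ((n : ℝ) - 1) = 2 ^ (n - 1) := by
      rw [← Real.rpow_natCast, Nat.cast_sub hn, Nat.cast_one]
    rw [h2]
    calc _ ≤ value v e (X e) * (2 ^ (n - 1) * ∏ i ∈ univ.erase e, value v i (Y i)) :=
          mul_le_mul_of_nonneg_left h1 (value_nonneg hv e _)
      _ = _ := by ring
  rw [IsEfficient, ← hopt, nashWelfare, nashWelfare]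
  refine (Real.rpow_le_rpow (prod_value_nonneg hv X) hprod (by positivity)).trans_eq ?_
  rw [Real.mul_rpow (by positivity) (prod_value_nonneg hv Y), ← Real.rpow_mul (by norm_num)]
  congr 2
  field_simp

lemma IsInput.returns (h : IsInput n m v X) {Y : Fin n → Finset (Fin m)}
    (hY : Returns v X Y) :
    IsAllocation (allocated Y) Y ∧ IsEFX v Y ∧
      IsEfficient v ((2 : ℝ) ^ (1 - 1 / (n : ℝ))) Y ∧
      ((0 < opt v univ ∨ ∀ i g, 0 < v i g) → ∀ i, Y i ⊆ X i) ∧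
      (0 < opt v univ →
        IsParetoOptimal v (allocated Y) Y ∧
        (∀ i, value v i (X i) ≤ 2 * value v i (Y i)) ∧ ∃ i, Y i = X i) := by
  obtain ⟨k, Z, M, hr, hM, hcard, hYZ⟩ := hY
  obtain ⟨σ, hσ⟩ := hM.1.1.exists_perm hcard
  have hYσ : ∀ i, Y i = Z (σ i) := fun i => hYZ _ (hσ i)
  have hsub := hr.subset
  have hone : (0 < opt v univ ∨ ∀ i g, 0 < v i g) → Y = Z := fun hc => by
    have := hM.perm_eq_one h hc hsub hσ
    subst this
    exact funext hYσ
  have halloc : IsAllocation (allocated Y) Y := by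
    refine ⟨fun i j hij => ?_, rfl⟩
    rw [hYσ, hYσ]
    exact (h.2.2.1.1 _ _ fun hh => hij (σ.injective hh)).mono (hsub _) (hsub _)
  refine ⟨halloc, fun i j => ?_, ?_, fun hc i => ?_, fun hpos => ?_⟩
  · rw [hYσ i, hYσ j]
    exact (hM.1.1.1 _ (hσ i)).1 _
  · by_cases hpos : 0 < opt v univ
    · obtain ⟨hhalf, e, he⟩ := hr.half_value h hpos
      rw [hone (Or.inl hpos)]
      exact h.isEfficient hhalf he
    · exact (not_lt.1 hpos).trans
        (mul_nonneg (Real.rpow_nonneg (by norm_num) _) (nashWelfare_nonneg h.2.1 Y))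
  · rw [hone hc]
    exact hsub i
  · have := hone (Or.inl hpos)
    subst this
    exact ⟨h.paretoOptimal hpos hsub halloc, hr.half_value h hpos⟩

end Combinatorics

/-! ### A calculus for time-bounded total correctness -/

/-- The program `p`, started on `s`, halts in a memory with the property `Q`, and each of its loops
makes at most `B` iterations whenever it is entered. For a loop this is witnessed by an invariant
`I f` that is indexed by a bound `f` on the number of the iterations that are still to come. -/
def wp (B : ℕ) : Program → (Memory → Prop) → Memory → Prop
  | .skip, Q, s => Q s
  | .setNat a i j x, Q, s => Q (s.setNat a (i.eval s) (j.eval s) (x.eval s))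
  | .setReal a i j x, Q, s => Q (s.setReal a (i.eval s) (j.eval s) (x.eval s))
  | .seq p q, Q, s => wp B p (wp B q Q) s
  | .cond b p q, Q, s => (b.Holds s → wp B p Q s) ∧ (¬ b.Holds s → wp B q Q s)
  | .loop b p, Q, s => ∃ I : ℕ → Memory → Prop, (∃ f ≤ B, I f s) ∧
      ∀ f s, I f s → (b.Holds s → wp B p (fun s' => ∃ f' < f, I f' s') s) ∧ (¬ b.Holds s → Q s)

/-- A bound on the running time of a program, as a polynomial in the maximum number of iterations
of its loops. -/
noncomputable def Program.timeBound : Program → Polynomial ℕ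
  | .skip => 1
  | .setNat _ i j x => Polynomial.C (i.cost + j.cost + x.cost + 1)
  | .setReal _ i j x => Polynomial.C (i.cost + j.cost + x.cost + 1)
  | .seq p q => p.timeBound + q.timeBound
  | .cond b p q => Polynomial.C (b.cost + 1) + p.timeBound + q.timeBound
  | .loop b p => (Polynomial.X + 1) * (Polynomial.C (b.cost + 1) + p.timeBound)

theorem wp.runs {B : ℕ} {p : Program} {Q : Memory → Prop} {s : Memory} (h : wp B p Q s) :
    ∃ t s', Runs p s t s' ∧ t ≤ p.timeBound.eval B ∧ Q s' := by
  induction p generalizing Q s with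
  | skip => exact ⟨_, _, .skip s, by simp [Program.timeBound], h⟩
  | setNat a i j x => exact ⟨_, _, .setNat a i j x s, by simp [Program.timeBound], h⟩
  | setReal a i j x => exact ⟨_, _, .setReal a i j x s, by simp [Program.timeBound], h⟩
  | seq p q ihp ihq =>
    obtain ⟨t, s', hr, ht, h'⟩ := ihp h
    obtain ⟨t', s'', hr', ht', h''⟩ := ihq h'
    refine ⟨_, _, .seq hr hr', ?_, h''⟩
    simp only [Program.timeBound, Polynomial.eval_add]
    omega
  | cond b p q ihp ihq =>
    by_cases hb : b.Holds s
    · obtain ⟨t, s', hr, ht, h'⟩ := ihp (h.1 hb)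
      refine ⟨_, _, .condTrue hb hr, ?_, h'⟩
      simp only [Program.timeBound, Polynomial.eval_add, Polynomial.eval_C]
      omega
    · obtain ⟨t, s', hr, ht, h'⟩ := ihq (h.2 hb)
      refine ⟨_, _, .condFalse hb hr, ?_, h'⟩
      simp only [Program.timeBound, Polynomial.eval_add, Polynomial.eval_C]
      omega
  | loop b p ih =>
    obtain ⟨I, ⟨f, hf, hI⟩, hstep⟩ := h
    have key : ∀ f s, I f s → ∃ t s', Runs (.loop b p) s t s' ∧
        t ≤ (f + 1) * (b.cost + 1 + p.timeBound.eval B) ∧ Q s' := by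
      intro f
      induction f using Nat.strong_induction_on with
      | _ f ihf =>
        intro s hs
        by_cases hb : b.Holds s
        · obtain ⟨t, s', hr, ht, f', hf', hI'⟩ := ih ((hstep f s hs).1 hb)
          obtain ⟨t', s'', hr', ht', hQ⟩ := ihf f' hf' s' hI'
          refine ⟨_, _, .loopStep hb hr hr', ?_, hQ⟩
          have : (f' + 1) * (b.cost + 1 + p.timeBound.eval B)
              ≤ f * (b.cost + 1 + p.timeBound.eval B) := Nat.mul_le_mul_right _ hf'
          rw [add_one_mul f]
          omega
        · refine ⟨_, _, .loopStop hb, ?_, (hstep f s hs).2 hb⟩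
          rw [add_one_mul]
          omega
    obtain ⟨t, s', hr, ht, hQ⟩ := key f s hI
    refine ⟨t, s', hr, ht.trans ?_, hQ⟩
    simp only [Program.timeBound, Polynomial.eval_add, Polynomial.eval_C, Polynomial.eval_mul,
      Polynomial.eval_X, Polynomial.eval_one]
    exact Nat.mul_le_mul_right _ (by omega)

/-- Whether the program contains a command that writes to table `a` of natural numbers. -/
def Program.writesNat : Program → ℕ → Bool
  | .skip, _ => false
  | .setNat b _ _ _, a => a == b
  | .setReal _ _ _ _, _ => false
  | .seq p q, a => p.writesNat a || q.writesNat a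
  | .cond _ p q, a => p.writesNat a || q.writesNat a
  | .loop _ p, a => p.writesNat a

/-- Whether the program contains a command that writes to table `a` of real numbers. -/
def Program.writesReal : Program → ℕ → Bool
  | .skip, _ => false
  | .setNat _ _ _ _, _ => false
  | .setReal b _ _ _, a => a == b
  | .seq p q, a => p.writesReal a || q.writesReal a
  | .cond _ p q, a => p.writesReal a || q.writesReal a
  | .loop _ p, a => p.writesReal a

/-- The memories `s` and `s'` agree on all tables that `p` does not write to. -/
structure Frame (p : Program) (s s' : Memory) : Prop where
  nat : ∀ a, p.writesNat a = false → s'.nat a = s.nat a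
  real : ∀ a, p.writesReal a = false → s'.real a = s.real a

lemma Frame.refl (p : Program) (s : Memory) : Frame p s s := ⟨fun _ _ => rfl, fun _ _ => rfl⟩

lemma Frame.trans {p : Program} {s s' s'' : Memory} (h : Frame p s s') (h' : Frame p s' s'') :
    Frame p s s'' :=
  ⟨fun a ha => (h'.nat a ha).trans (h.nat a ha), fun a ha => (h'.real a ha).trans (h.real a ha)⟩

lemma Frame.mono {p q : Program} {s s' : Memory} (h : Frame p s s')
    (hn : ∀ a, q.writesNat a = false → p.writesNat a = false)
    (hr : ∀ a, q.writesReal a = false → p.writesReal a = false) : Frame q s s' :=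
  ⟨fun a ha => h.nat a (hn a ha), fun a ha => h.real a (hr a ha)⟩

lemma Frame.seq_left {p q : Program} {s s' : Memory} (h : Frame p s s') :
    Frame (.seq p q) s s' :=
  h.mono (fun _ ha => (Bool.or_eq_false_iff.1 ha).1) (fun _ ha => (Bool.or_eq_false_iff.1 ha).1)

lemma Frame.seq_right {p q : Program} {s s' : Memory} (h : Frame q s s') :
    Frame (.seq p q) s s' :=
  h.mono (fun _ ha => (Bool.or_eq_false_iff.1 ha).2) (fun _ ha => (Bool.or_eq_false_iff.1 ha).2)

lemma Memory.setNat_nat (s : Memory) (a i j x b k l : ℕ) :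
    (s.setNat a i j x).nat b k l = if b = a ∧ k = i ∧ l = j then x else s.nat b k l := rfl

lemma Memory.setNat_real (s : Memory) (a i j x : ℕ) : (s.setNat a i j x).real = s.real := rfl

lemma Memory.setReal_real (s : Memory) (a i j b k l : ℕ) (x : ℝ) :
    (s.setReal a i j x).real b k l = if b = a ∧ k = i ∧ l = j then x else s.real b k l := rfl

lemma Memory.setReal_nat (s : Memory) (a i j : ℕ) (x : ℝ) : (s.setReal a i j x).nat = s.nat := rfl

lemma frame_setNat (a : ℕ) (i j x : NatExpr) (s : Memory) (k l y : ℕ) :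
    Frame (.setNat a i j x) s (s.setNat a k l y) := by
  refine ⟨fun b hb => ?_, fun _ _ => rfl⟩
  have hb : b ≠ a := by simpa [Program.writesNat] using hb
  funext k' l'
  simp [Memory.setNat_nat, hb]

lemma frame_setReal (a : ℕ) (i j : NatExpr) (x : RealExpr) (s : Memory) (k l : ℕ) (y : ℝ) :
    Frame (.setReal a i j x) s (s.setReal a k l y) := by
  refine ⟨fun _ _ => rfl, fun b hb => ?_⟩
  have hb : b ≠ a := by simpa [Program.writesReal] using hb
  funext k' l'
  simp [Memory.setReal_real, hb]

/-- The consequence rule, strengthened by the information on the tables that are not written to. -/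
theorem wp.imp {B : ℕ} {p : Program} {Q R : Memory → Prop} {s : Memory} (h : wp B p Q s)
    (hQR : ∀ s', Frame p s s' → Q s' → R s') : wp B p R s := by
  induction p generalizing Q R s with
  | skip => exact hQR s (Frame.refl _ s) h
  | setNat a i j x => exact hQR _ (frame_setNat ..) h
  | setReal a i j x => exact hQR _ (frame_setReal ..) h
  | seq p q ihp ihq =>
    exact ihp h fun s' h' hq => ihq hq fun s'' h'' => hQR s'' (h'.seq_left.trans h''.seq_right)
  | cond b p q ihp ihq =>
    exact ⟨fun hb => ihp (h.1 hb) fun s' h' =>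
        hQR s' ⟨(h'.seq_left (q := q)).nat, (h'.seq_left (q := q)).real⟩,
      fun hb => ihq (h.2 hb) fun s' h' =>
        hQR s' ⟨(h'.seq_right (p := p)).nat, (h'.seq_right (p := p)).real⟩⟩
  | loop b p ih =>
    obtain ⟨I, ⟨f, hf, hI⟩, hstep⟩ := h
    refine ⟨fun f s' => I f s' ∧ Frame p s s', ⟨f, hf, hI, Frame.refl _ _⟩, ?_⟩
    rintro f s' ⟨hI', hF⟩
    refine ⟨fun hb => ih ((hstep f s' hI').1 hb) ?_, fun hb =>
      hQR s' ⟨hF.nat, hF.real⟩ ((hstep f s' hI').2 hb)⟩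
    rintro s'' hF' ⟨f', hf', hI''⟩
    exact ⟨f', hf', hI'', hF.trans hF'⟩

/-- The value of the entry `(0, 0)` of table `a`, used as a variable. -/
def NatExpr.var (a : ℕ) : NatExpr := .cell a (.const 0) (.const 0)

/-- The test `x < y`. -/
def Test.natLt (x y : NatExpr) : Test := .natLe (.add x (.const 1)) y

/-- `for c := 0, 1, ..., bd - 1 do p`, where the counter is the variable of table `c`. -/
def Program.forLoop (c : ℕ) (bd : NatExpr) (p : Program) : Program :=
  .seq (.setNat c (.const 0) (.const 0) (.const 0))
    (.loop (.natLt (.var c) bd)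
      (.seq p (.setNat c (.const 0) (.const 0) (.add (.var c) (.const 1)))))

theorem wp_forLoop {B c : ℕ} {bd : NatExpr} {p : Program} {Q : Memory → Prop} {s : Memory} {N : ℕ}
    (hN : N ≤ B) (I : ℕ → Memory → Prop) (hc : p.writesNat c = false)
    (hbd : ∀ s', Frame (.forLoop c bd p) s s' → bd.eval s' = N)
    (h0 : I 0 (s.setNat c 0 0 0))
    (hstep : ∀ k < N, ∀ s', Frame (.forLoop c bd p) s s' → s'.nat c 0 0 = k → I k s' →
      wp B p (fun s'' => I (k + 1) (s''.setNat c 0 0 (k + 1))) s')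
    (hQ : ∀ s', Frame (.forLoop c bd p) s s' → I N s' → Q s') :
    wp B (.forLoop c bd p) Q s := by
  refine ⟨fun f s' => ∃ k, k + f = N ∧ s'.nat c 0 0 = k ∧ Frame (.forLoop c bd p) s s' ∧ I k s',
    ⟨N, hN, 0, by omega, ?_, ?_, h0⟩, ?_⟩
  · simp [Memory.setNat_nat, NatExpr.eval]
  · exact (frame_setNat ..).seq_left
  · rintro f s' ⟨k, hk, hck, hF, hI⟩
    have hb : (Test.natLt (.var c) bd).Holds s' ↔ k < N := by
      simp only [Test.natLt, Test.Holds, NatExpr.eval, NatExpr.var, hck, hbd s' hF]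
      exact Iff.rfl
    refine ⟨fun hlt => ?_, fun hlt => hQ s' hF ?_⟩
    swap
    · have := mt hb.2 hlt
      rwa [show N = k by omega]
    have hlt := hb.1 hlt
    refine (hstep k hlt s' hF hck hI).imp fun s'' hF' hI' => ?_
    have hcs : s''.nat c 0 0 = k := by rw [hF'.nat c hc, hck]
    have heval : (NatExpr.add (.var c) (.const 1)).eval s'' = k + 1 := by
      simp [NatExpr.eval, NatExpr.var, hcs]
    simp only [wp]
    rw [heval]
    refine ⟨f - 1, by omega, k + 1, by omega, by simp [Memory.setNat_nat, NatExpr.eval], ?_, hI'⟩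
    refine hF.trans (Frame.trans (s' := s'') ?_
      (frame_setNat c (.const 0) (.const 0) (.const 0) s'' 0 0 (k + 1)).seq_left)
    exact hF'.mono (fun a ha => (Bool.or_eq_false_iff.1 (Bool.or_eq_false_iff.1 ha).2).1)
      (fun a ha => (Bool.or_eq_false_iff.1 (Bool.or_eq_false_iff.1 ha).2).1)

/-- A loop whose `k`-th iteration establishes `Φ k` and does not destroy the other `Φ l`. -/
theorem wp_forLoop_all {B c : ℕ} {bd : NatExpr} {p : Program} {Q : Memory → Prop} {s : Memory}
    {N : ℕ} (hN : N ≤ B) (Φ : ℕ → Memory → Prop) (hc : p.writesNat c = false)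
    (hbd : ∀ s', Frame (.forLoop c bd p) s s' → bd.eval s' = N)
    (hΦ : ∀ k s' x, Φ k s' → Φ k (s'.setNat c 0 0 x))
    (hstep : ∀ k < N, ∀ s', Frame (.forLoop c bd p) s s' → s'.nat c 0 0 = k →
      wp B p (fun s'' => Φ k s'' ∧ ∀ l, l ≠ k → Φ l s' → Φ l s'') s')
    (hQ : ∀ s', Frame (.forLoop c bd p) s s' → (∀ k < N, Φ k s') → Q s') :
    wp B (.forLoop c bd p) Q s := by
  refine wp_forLoop hN (fun k s' => ∀ l < k, Φ l s') hc hbd (by simp) ?_ hQ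
  intro k hk s' hF hck hI
  refine (hstep k hk s' hF hck).imp fun s'' _ h l hl => hΦ _ _ _ ?_
  by_cases hlk : l = k
  · exact hlk ▸ h.1
  · exact h.2 l hlk (hI l (by omega))

/-- Two nested loops whose iteration `(i, j)` establishes `Φ i j` and does not destroy the other
`Φ k l`. -/
theorem wp_forLoop_forLoop {B c d : ℕ} {bd bd' : NatExpr} {p : Program} {Q : Memory → Prop}
    {s : Memory} {N N' : ℕ} (hN : N ≤ B) (hN' : N' ≤ B) (Φ : ℕ → ℕ → Memory → Prop)
    (hcd : (c == d) = false) (hc : p.writesNat c = false) (hd : p.writesNat d = false)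
    (hbd : ∀ s', Frame (.forLoop c bd (.forLoop d bd' p)) s s' → bd.eval s' = N)
    (hbd' : ∀ s', Frame (.forLoop c bd (.forLoop d bd' p)) s s' → bd'.eval s' = N')
    (hΦc : ∀ i j s' x, Φ i j s' → Φ i j (s'.setNat c 0 0 x))
    (hΦd : ∀ i j s' x, Φ i j s' → Φ i j (s'.setNat d 0 0 x))
    (hstep : ∀ i < N, ∀ j < N', ∀ s', Frame (.forLoop c bd (.forLoop d bd' p)) s s' →
      s'.nat c 0 0 = i → s'.nat d 0 0 = j →
      wp B p (fun s'' => Φ i j s'' ∧ ∀ k l, ¬ (k = i ∧ l = j) → Φ k l s' → Φ k l s'') s')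
    (hQ : ∀ s', Frame (.forLoop c bd (.forLoop d bd' p)) s s' →
      (∀ i < N, ∀ j < N', Φ i j s') → Q s') :
    wp B (.forLoop c bd (.forLoop d bd' p)) Q s := by
  have hcq : (Program.forLoop d bd' p).writesNat c = false := by
    simp [Program.forLoop, Program.writesNat, hc, hcd]
  have hmono : ∀ {s s' : Memory}, Frame (.forLoop d bd' p) s s' →
      Frame (.forLoop c bd (.forLoop d bd' p)) s s' := fun h =>
    h.mono (fun a ha => (Bool.or_eq_false_iff.1 (Bool.or_eq_false_iff.1 ha).2).1)
      (fun a ha => (Bool.or_eq_false_iff.1 (Bool.or_eq_false_iff.1 ha).2).1)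
  refine wp_forLoop hN (fun i s' => ∀ k < i, ∀ l < N', Φ k l s') hcq hbd (by simp) ?_ hQ
  intro i hi s' hF hci hI
  refine wp_forLoop hN' (fun j s'' => ∀ k l, l < N' → (k < i ∨ k = i ∧ l < j) → Φ k l s'') hd
    (fun s'' hF' => hbd' s'' (hF.trans (hmono hF'))) ?_ ?_ ?_
  · intro k l hl hkl
    exact hΦd _ _ _ _ (hI k (by omega) l hl)
  · intro j hj s'' hF' hdj hI'
    have hci' : s''.nat c 0 0 = i := by rw [hF'.nat c hcq, hci]
    refine (hstep i hi j hj s'' (hF.trans (hmono hF')) hci' hdj).imp fun s₃ _ h k l hl hkl => ?_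
    refine hΦd _ _ _ _ ?_
    by_cases hkl' : k = i ∧ l = j
    · rw [hkl'.1, hkl'.2]; exact h.1
    · exact h.2 k l hkl' (hI' k l hl (by omega))
  · intro s'' _ hI' k hk l hl
    exact hΦc _ _ _ _ (hI' k l hl (by omega))

/-! ### The auction -/

/-- The invariant of the auction in which `n` agents bid for `n` bundles. The value of bundle `j`
for agent `i` is `w i j ≤ C`, its price is `p j`, and `asg i` is the bundle that agent `i` holds,
where `asg i = n` means that she holds none. -/
structure AuctionInv (n C : ℕ) (w : ℕ → ℕ → ℕ) (p asg : ℕ → ℕ) : Prop where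
  asg_le : ∀ i < n, asg i ≤ n
  inj : ∀ i < n, ∀ i' < n, asg i = asg i' → asg i < n → i = i'
  near : ∀ i < n, asg i < n → ∀ k < n, w i k + p (asg i) ≤ w i (asg i) + p k + 1
  zero : ∀ j < n, (∀ i < n, asg i ≠ j) → p j = 0
  price_le : ∀ j < n, p j ≤ C + 1

/-- As long as some agent holds no bundle, some bundle is held by nobody. -/
lemma exists_free_bundle {n : ℕ} {asg : ℕ → ℕ} {u : ℕ} (hu : u < n) (hasg : n ≤ asg u) :
    ∃ j < n, ∀ i < n, asg i ≠ j := by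
  by_contra! hall
  choose! g hg using hall
  let G : Fin n → Fin n := fun j => ⟨g j, (hg j j.2).1⟩
  have hinj : Function.Injective G := by
    intro j j' hjj
    have : g j = g j' := congrArg Fin.val hjj
    exact Fin.ext (by rw [← (hg j j.2).2, this, (hg j' j'.2).2])
  obtain ⟨j, hj⟩ := Finite.injective_iff_surjective.1 hinj ⟨u, hu⟩
  have h1 : g j = u := congrArg Fin.val hj
  have h2 := (hg j j.2).2
  have := j.2
  rw [h1] at h2
  omega

lemma AuctionInv.start (n C : ℕ) (w : ℕ → ℕ → ℕ) {p asg : ℕ → ℕ} (hp : ∀ j < n, p j = 0)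
    (hasg : ∀ i < n, asg i = n) : AuctionInv n C w p asg where
  asg_le i hi := (hasg i hi).le
  inj i hi _ _ _ hlt := absurd (hasg i hi) hlt.ne
  near i hi hlt := absurd (hasg i hi) hlt.ne
  zero j hj _ := hp j hj
  price_le j hj := by rw [hp j hj]; exact Nat.zero_le _

/-- The agent `u` without a bundle takes a bundle `b` of maximum surplus and raises its price. The
price of `b` was at most `C` since the surplus of an unsold bundle, of price `0`, is nonnegative. -/
lemma AuctionInv.bid {n C : ℕ} {w : ℕ → ℕ → ℕ} {p asg p' asg' : ℕ → ℕ}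
    (h : AuctionInv n C w p asg) (hw : ∀ i < n, ∀ j < n, w i j ≤ C) {u b : ℕ} (hu : u < n)
    (hasg : n ≤ asg u) (hb : b < n) (hbest : ∀ k < n, w u k + p b ≤ w u b + p k)
    (hpb : p' b = p b + 1) (hp : ∀ j < n, j ≠ b → p' j = p j)
    (hub : asg' u = b) (hfree : ∀ i < n, i ≠ u → asg i = b → asg' i = n)
    (hkeep : ∀ i < n, i ≠ u → asg i ≠ b → asg' i = asg i) : AuctionInv n C w p' asg' := by
  have hle : ∀ k < n, p k ≤ p' k := by
    intro k hk
    by_cases hkb : k = b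
    · subst hkb; omega
    · rw [hp k hk hkb]
  have hcase : ∀ i < n, i ≠ u → asg' i < n → asg' i = asg i ∧ asg i ≠ b := by
    intro i hi hiu hlt
    by_cases hib : asg i = b
    · have := hfree i hi hiu hib; omega
    · exact ⟨hkeep i hi hiu hib, hib⟩
  refine ⟨fun i hi => ?_, fun i hi i' hi' hii hlt => ?_, fun i hi hlt k hk => ?_,
    fun j hj hfr => ?_, fun j hj => ?_⟩
  · by_cases hiu : i = u
    · subst hiu; omega
    · by_cases hib : asg i = b
      · exact (hfree i hi hiu hib).le
      · rw [hkeep i hi hiu hib]; exact h.asg_le i hi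
  · by_cases hiu : i = u <;> by_cases hiu' : i' = u
    · rw [hiu, hiu']
    · have := hcase i' hi' hiu' (hii ▸ hlt)
      subst hiu
      omega
    · have := hcase i hi hiu hlt
      subst hiu'
      omega
    · have h1 := hcase i hi hiu hlt
      have h2 := hcase i' hi' hiu' (hii ▸ hlt)
      exact h.inj i hi i' hi' (by omega) (by omega)
  · by_cases hiu : i = u
    · subst hiu
      have := hbest k hk
      have := hle k hk
      rw [hub]
      omega
    · obtain ⟨h1, h2⟩ := hcase i hi hiu hlt
      rw [h1] at hlt ⊢
      have := h.near i hi hlt k hk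
      have := hle k hk
      rw [hp _ hlt h2]
      omega
  · have hjb : j ≠ b := fun hjb => hfr u hu (hub.trans hjb.symm)
    rw [hp j hj hjb]
    refine h.zero j hj fun i hi hij => ?_
    have hiu : i ≠ u := by rintro rfl; omega
    exact hfr i hi ((hkeep i hi hiu (by rwa [hij])).trans hij)
  · by_cases hjb : j = b
    · subst hjb
      obtain ⟨k, hk, hfr⟩ := exists_free_bundle hu hasg
      have h1 := h.zero k hk hfr
      have h2 := hbest k hk
      have h3 := hw u hu j hj
      omega
    · rw [hp j hj hjb]
      exact h.price_le j hj

/-- The final assignment of the auction is within `n` of the total weight of any matching. -/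
lemma AuctionInv.exists_perm {n C : ℕ} {w : ℕ → ℕ → ℕ} {p asg : ℕ → ℕ}
    (h : AuctionInv n C w p asg) (hall : ∀ i < n, asg i < n) :
    ∃ σ : Equiv.Perm (Fin n), (∀ i : Fin n, (σ i : ℕ) = asg i) ∧
      ∀ M : Finset (Fin n × Fin n), (∀ e ∈ M, ∀ e' ∈ M, (e.1 = e'.1 ∨ e.2 = e'.2) → e = e') →
        ∑ e ∈ M, w e.1 e.2 ≤ ∑ i, w (i : Fin n) (σ i) + n := by
  let f : Fin n → Fin n := fun i => ⟨asg i, hall i i.2⟩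
  have hinj : Function.Injective f := fun i i' hii =>
    Fin.ext (h.inj i i.2 i' i'.2 (congrArg Fin.val hii) (hall i i.2))
  let σ := Equiv.ofBijective f (Finite.injective_iff_bijective.1 hinj)
  have hσ : ∀ i : Fin n, (σ i : ℕ) = asg i := fun i => rfl
  refine ⟨σ, hσ, fun M hM => ?_⟩
  classical
  -- Extend the matching to a permutation `τ`.
  have hfst : Set.InjOn Prod.fst (M : Set (Fin n × Fin n)) :=
    fun e he e' he' hee => hM e he e' he' (Or.inl hee)
  obtain ⟨g, hg⟩ : ∃ g : Fin n → Fin n, ∀ e ∈ M, g e.1 = e.2 := by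
    refine ⟨fun i => if hi : ∃ b, (i, b) ∈ M then hi.choose else i, fun e he => ?_⟩
    have hex : ∃ b, (e.1, b) ∈ M := ⟨e.2, he⟩
    simp only [dif_pos hex]
    exact congrArg Prod.snd (hM _ hex.choose_spec e he (Or.inl rfl))
  obtain ⟨τ, hτ⟩ := Finset.exists_equiv_extend_of_card_eq (t := (univ : Finset (Fin n)))
    (s := M.image Prod.fst) (f := g) (by simp) (subset_univ _) (by
      intro i hi i' hi' hii
      simp only [coe_image, Set.mem_image, mem_coe] at hi hi'
      obtain ⟨e, he, rfl⟩ := hi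
      obtain ⟨e', he', rfl⟩ := hi'
      rw [hg e he, hg e' he'] at hii
      rw [hM e he e' he' (Or.inr hii)])
  have h1 : ∑ e ∈ M, w e.1 e.2 ≤ ∑ i : Fin n, w i (τ i : Fin n) := by
    have : ∑ e ∈ M, w e.1 e.2 = ∑ i ∈ M.image Prod.fst, w i (τ i : Fin n) := by
      rw [sum_image hfst]
      refine sum_congr rfl fun e he => ?_
      rw [hτ _ (mem_image_of_mem _ he), hg e he]
    rw [this]
    exact sum_le_sum_of_subset (subset_univ _)
  have h2 : ∑ i : Fin n, (w i (τ i : Fin n) + p (σ i : Fin n))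
      ≤ ∑ i : Fin n, (w i (σ i : Fin n) + p (τ i : Fin n) + 1) :=
    sum_le_sum fun i _ => h.near i i.2 (hall i i.2) _ (τ i : Fin n).2
  have h3 : ∑ i : Fin n, p (σ i : Fin n) = ∑ j : Fin n, p j :=
    Equiv.sum_comp σ fun j : Fin n => p j
  have h4 : ∑ i : Fin n, p (τ i : Fin n) = ∑ j : Fin n, p j := by
    have : Function.Injective fun i => (τ i : Fin n) :=
      Subtype.val_injective.comp τ.injective
    exact Function.Bijective.sum_comp (Finite.injective_iff_bijective.1 this) fun j : Fin n => p j
  simp only [sum_add_distrib, sum_const, card_univ, Fintype.card_fin, smul_eq_mul, mul_one] at h2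
  omega

/-! ### Selected matchings as matchings of maximum weight -/

section Selection

variable {n m : ℕ} {v : Fin n → Fin m → ℝ} {X Z : Fin n → Finset (Fin m)}

open Classical in
/-- The weight of the pair `(i, j)` in the auction. With `N = n + 1` the weight of a matching is
`N` times the number whose digits to the base `N` count the touched bundles, the own edges, and all
edges. So maximizing it up to an error of `n < N` maximizes these numbers lexicographically. -/
noncomputable def edgeWeight (v : Fin n → Fin m → ℝ) (X Z : Fin n → Finset (Fin m))
    (i j : Fin n) : ℕ :=
  if IsEdge v Z i j then
    (n + 1) + (if i = j then (n + 1) ^ 2 else 0) + (if Z j ≠ X j then (n + 1) ^ 3 else 0)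
  else 0

lemma edgeWeight_le (i j : Fin n) :
    edgeWeight v X Z i j ≤ (n + 1) + (n + 1) ^ 2 + (n + 1) ^ 3 := by
  rw [edgeWeight]
  split_ifs <;> omega

lemma edgeWeight_eq_zero_iff (i j : Fin n) : edgeWeight v X Z i j = 0 ↔ ¬ IsEdge v Z i j := by
  rw [edgeWeight]
  split_ifs with h <;> simp [h]

open Classical in
lemma sum_edgeWeight {M : Finset (Fin n × Fin n)} (hM : ∀ e ∈ M, IsEdge v Z e.1 e.2) :
    ∑ e ∈ M, edgeWeight v X Z e.1 e.2 = (n + 1) *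
      (M.card + (n + 1) * ownEdges M + (n + 1) ^ 2 * (M.filter fun e => Z e.2 ≠ X e.2).card) := by
  have : ∀ e ∈ M, edgeWeight v X Z e.1 e.2 = (n + 1) + (if e.1 = e.2 then (n + 1) ^ 2 else 0)
      + (if Z e.2 ≠ X e.2 then (n + 1) ^ 3 else 0) := fun e he => by
    rw [edgeWeight, if_pos (hM e he)]
  rw [sum_congr rfl this, sum_add_distrib, sum_add_distrib, ← sum_filter, ← sum_filter, sum_const,
    sum_const, sum_const, ownEdges]
  simp only [smul_eq_mul]
  ring

lemma IsMatching.card_le {M : Finset (Fin n × Fin n)} (hM : IsMatching v Z M) : M.card ≤ n := by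
  rw [← card_image_of_injOn (s := M) (f := Prod.fst)
    fun e he e' he' hee => hM.2 e he e' he' (Or.inl hee)]
  simpa using card_le_univ (M.image Prod.fst)

open Classical in
/-- A permutation whose weight is within `n` of the weight of any matching yields a selected
matching: drop the pairs that are not edges. -/
lemma isSelected_of_weight (hex : ∃ M, IsMatching v Z M ∧ CoversTouched X Z M)
    {σ : Equiv.Perm (Fin n)}
    (hσ : ∀ M, IsMatching v Z M →
      ∑ e ∈ M, edgeWeight v X Z e.1 e.2 ≤ ∑ i, edgeWeight v X Z i (σ i) + n) :
    IsSelected v X Z ((univ.filter fun i => IsEdge v Z i (σ i)).image fun i => (i, σ i)) := by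
  set M := (univ.filter fun i => IsEdge v Z i (σ i)).image fun i => (i, σ i) with hMdef
  have hinj : Function.Injective fun i => (i, σ i) := fun i j hij => congrArg Prod.fst hij
  have hM : IsMatching v Z M := by
    refine ⟨fun e he => ?_, fun e he e' he' hee => ?_⟩
    · obtain ⟨i, hi, rfl⟩ := mem_image.1 he
      exact (mem_filter.1 hi).2
    · obtain ⟨i, hi, rfl⟩ := mem_image.1 he
      obtain ⟨i', hi', rfl⟩ := mem_image.1 he'
      rcases hee with h | h
      · simp only at h; rw [h]
      · rw [σ.injective h]
  have hsum : ∑ i, edgeWeight v X Z i (σ i) = ∑ e ∈ M, edgeWeight v X Z e.1 e.2 := by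
    rw [hMdef, sum_image fun i _ j _ hij => hinj hij, sum_filter]
    refine sum_congr rfl fun i _ => ?_
    split_ifs with hi
    · rfl
    · exact (edgeWeight_eq_zero_iff _ _).2 hi
  let touched := univ.filter fun j => Z j ≠ X j
  have hsnd : ∀ {M'}, IsMatching v Z M' →
      (M'.filter fun e => Z e.2 ≠ X e.2).card
        = ((M'.filter fun e => Z e.2 ≠ X e.2).image Prod.snd).card := fun hM' => by
    rw [card_image_of_injOn fun e he e' he' hee =>
      hM'.2 e (mem_filter.1 he).1 e' (mem_filter.1 he').1 (Or.inr hee)]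
  have hsub : ∀ M' : Finset (Fin n × Fin n),
      (M'.filter fun e => Z e.2 ≠ X e.2).image Prod.snd ⊆ touched := fun M' j hj => by
    obtain ⟨e, he, rfl⟩ := mem_image.1 hj
    exact mem_filter.2 ⟨mem_univ _, (mem_filter.1 he).2⟩
  have htouched : ∀ {M'}, IsMatching v Z M' →
      (M'.filter fun e => Z e.2 ≠ X e.2).card ≤ touched.card := fun hM' => by
    rw [hsnd hM']
    exact card_le_card (hsub _)
  have hcovers : ∀ {M'}, IsMatching v Z M' → (CoversTouched X Z M' ↔
      (M'.filter fun e => Z e.2 ≠ X e.2).card = touched.card) := by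
    intro M' hM'
    rw [hsnd hM']
    constructor
    · intro hc
      congr 1
      refine (hsub M').antisymm fun j hj => ?_
      have hj' := (mem_filter.1 hj).2
      obtain ⟨e, he, rfl⟩ := hc j hj'
      exact mem_image.2 ⟨e, mem_filter.2 ⟨he, hj'⟩, rfl⟩
    · intro hc j hj
      have hmem : j ∈ (M'.filter fun e => Z e.2 ≠ X e.2).image Prod.snd := by
        rw [eq_of_subset_of_card_le (hsub M') hc.ge]
        exact mem_filter.2 ⟨mem_univ _, hj⟩
      obtain ⟨e, he, rfl⟩ := mem_image.1 hmem
      exact ⟨e, (mem_filter.1 he).1, rfl⟩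
  have hown : ∀ M' : Finset (Fin n × Fin n), ownEdges M' ≤ M'.card := fun M' =>
    card_le_card (filter_subset _ _)
  have hcmp : ∀ {M'}, IsMatching v Z M' →
      M'.card + (n + 1) * ownEdges M' + (n + 1) ^ 2 * (M'.filter fun e => Z e.2 ≠ X e.2).card
        ≤ M.card + (n + 1) * ownEdges M
          + (n + 1) ^ 2 * (M.filter fun e => Z e.2 ≠ X e.2).card := by
    intro M' hM'
    have h := hσ M' hM'
    rw [hsum, sum_edgeWeight hM'.1, sum_edgeWeight hM.1] at h
    by_contra! hlt
    have := Nat.mul_le_mul_left (n + 1) (Nat.succ_le_of_lt hlt)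
    rw [Nat.succ_eq_add_one, mul_add_one] at this
    omega
  have hcard := hM.card_le
  have hownM := hown M
  have hcov : (M.filter fun e => Z e.2 ≠ X e.2).card = touched.card := by
    obtain ⟨M₀, hM₀, hcov₀⟩ := hex
    have h := hcmp hM₀
    rw [(hcovers hM₀).1 hcov₀] at h
    refine le_antisymm (htouched hM) ?_
    by_contra! hlt
    have h1 := Nat.mul_le_mul_left ((n + 1) ^ 2) (Nat.succ_le_of_lt hlt)
    rw [Nat.succ_eq_add_one, mul_add_one] at h1
    have h2 : (n + 1) * ownEdges M ≤ (n + 1) * n := Nat.mul_le_mul_left _ (hownM.trans hcard)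
    have h3 : (n + 1) ^ 2 = (n + 1) * n + n + 1 := by ring
    omega
  refine ⟨⟨hM, (hcovers hM).2 hcov⟩, fun M' hM' hc => ?_, fun M' hM' hc ho => ?_⟩
  · have h := hcmp hM'
    rw [(hcovers hM').1 hc, hcov] at h
    by_contra! hlt
    have := Nat.mul_le_mul_left (n + 1) (Nat.succ_le_of_lt hlt)
    rw [Nat.succ_eq_add_one, mul_add_one] at this
    omega
  · have h := hcmp hM'
    rw [(hcovers hM').1 hc, hcov, ho] at h
    omega

end Selection

/-! ### The program -/

/-!
The tables of natural numbers are: `0` numbers of agents and items, `1` current bundles, `2` output,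
`3` flags of the touched bundles, `4` powers of `n + 1`, `5`, `6`, `7` loop counters, `9` least
valued items, `10` robust demands, `11` weights, `12` prices, `13` bundles held in the auction,
`14` an agent, `15` a bundle, `16` the flag that the algorithm has stopped. The tables of real
numbers are: `0` valuations, `1` values of bundles, `2` drops of bundles.
-/

section Programs

open Program Test

/-- The number of agents. -/
def agents : NatExpr := .cell 0 (.const 0) (.const 0)

/-- The number of items. -/
def items : NatExpr := .cell 0 (.const 0) (.const 1)

/-- Entry `x` of row `0` of table `a`, used as a one-dimensional array. -/
def NatExpr.entry (a : ℕ) (x : NatExpr) : NatExpr := .cell a (.const 0) x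

/-- Computes the value and the drop of the bundle in variable `6` for the agent in variable `5`,
and an item of least value in it (the number of items as long as none has been found). -/
def evalBundle : Program :=
  seq (setReal 1 (.var 5) (.var 6) .zero) <|
  seq (setNat 9 (.var 5) (.var 6) items) <|
  seq (forLoop 7 items <|
    cond (natLe (.const 1) (.cell 1 (.var 6) (.var 7)))
      (seq (setReal 1 (.var 5) (.var 6)
          (.add (.cell 1 (.var 5) (.var 6)) (.cell 0 (.var 5) (.var 7))))
        (cond (.and (natLt (.cell 9 (.var 5) (.var 6)) items)
            (realLe (.cell 0 (.var 5) (.cell 9 (.var 5) (.var 6))) (.cell 0 (.var 5) (.var 7))))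
          skip (setNat 9 (.var 5) (.var 6) (.var 7))))
      skip) <|
  cond (natLt (.cell 9 (.var 5) (.var 6)) items)
    (setReal 2 (.var 5) (.var 6)
      (.sub (.cell 1 (.var 5) (.var 6)) (.cell 0 (.var 5) (.cell 9 (.var 5) (.var 6)))))
    (setReal 2 (.var 5) (.var 6) .zero)

/-- Evaluates all bundles for all agents. -/
def evalAll : Program := forLoop 5 agents <| forLoop 6 agents evalBundle

/-- Finds a robust demand of each agent. -/
def findDemands : Program :=
  forLoop 5 agents <|
  seq (setNat 10 (.const 0) (.var 5) (.const 0)) <|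
  forLoop 6 agents <|
  cond (realLe (.cell 2 (.var 5) (.entry 10 (.var 5))) (.cell 2 (.var 5) (.var 6)))
    (setNat 10 (.const 0) (.var 5) (.var 6)) skip

/-- Computes the weights of all pairs of an agent and a bundle from the numbers in table `4`. -/
def setWeights : Program :=
  forLoop 5 agents <| forLoop 6 agents <|
  seq (setNat 11 (.var 5) (.var 6) (.const 0)) <|
  cond (.and (realLe (.cell 2 (.var 5) (.entry 10 (.var 5))) (.cell 1 (.var 5) (.var 6)))
      (.not (.and (.not (.and (natLe (.var 5) (.var 6)) (natLe (.var 6) (.var 5))))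
        (realLe (.cell 1 (.var 5) (.var 6)) (.cell 1 (.var 5) (.var 5))))))
    (seq (setNat 11 (.var 5) (.var 6) (.entry 4 (.const 1))) <|
     seq (cond (.and (natLe (.var 5) (.var 6)) (natLe (.var 6) (.var 5)))
       (setNat 11 (.var 5) (.var 6) (.add (.cell 11 (.var 5) (.var 6)) (.entry 4 (.const 2))))
       skip) <|
     cond (natLe (.const 1) (.entry 3 (.var 6)))
       (setNat 11 (.var 5) (.var 6) (.add (.cell 11 (.var 5) (.var 6)) (.entry 4 (.const 3))))
       skip)
    skip

/-- Sets variable `14` to an agent with the property `b`, in which the agent is variable `5`, or to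
the number of agents if there is none. -/
def findAgent (b : Test) : Program :=
  seq (setNat 14 (.const 0) (.const 0) agents) <|
  forLoop 5 agents <| cond b (setNat 14 (.const 0) (.const 0) (.var 5)) skip

/-- The agent in variable `14` takes a bundle of maximum surplus and raises its price. -/
def makeBid : Program :=
  seq (setNat 15 (.const 0) (.const 0) (.const 0)) <|
  seq (forLoop 6 agents <|
    cond (natLe (.add (.cell 11 (.var 14) (.var 15)) (.entry 12 (.var 6)))
        (.add (.cell 11 (.var 14) (.var 6)) (.entry 12 (.var 15))))
      (setNat 15 (.const 0) (.const 0) (.var 6)) skip) <|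
  seq (setNat 12 (.const 0) (.var 15) (.add (.entry 12 (.var 15)) (.const 1))) <|
  seq (forLoop 5 agents <|
    cond (.and (natLe (.entry 13 (.var 5)) (.var 15)) (natLe (.var 15) (.entry 13 (.var 5))))
      (setNat 13 (.const 0) (.var 5) agents) skip) <|
  setNat 13 (.const 0) (.var 14) (.var 15)

/-- Computes an assignment of bundles to agents by an auction. -/
def auction : Program :=
  seq (forLoop 5 agents <|
    seq (setNat 12 (.const 0) (.var 5) (.const 0)) (setNat 13 (.const 0) (.var 5) agents)) <|
  seq (findAgent (natLe agents (.entry 13 (.var 5)))) <|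
  loop (natLt (.var 14) agents) (seq makeBid (findAgent (natLe agents (.entry 13 (.var 5)))))

/-- A round: computes a selected matching; then either removes an item or sets variable `16`. -/
def round : Program :=
  seq evalAll <| seq findDemands <| seq setWeights <| seq auction <|
  seq (findAgent (natLe (.cell 11 (.var 5) (.entry 13 (.var 5))) (.const 0))) <|
  cond (natLt (.var 14) agents)
    (seq (setNat 1 (.entry 10 (.var 14)) (.cell 9 (.var 14) (.entry 10 (.var 14))) (.const 0))
      (setNat 3 (.const 0) (.entry 10 (.var 14)) (.const 1)))
    (setNat 16 (.const 0) (.const 0) (.const 1))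

/-- Computes entry `k + 1` of table `4` as `n + 1` times entry `k`. -/
def setPower (k : ℕ) : Program :=
  seq (setNat 4 (.const 0) (.const (k + 1)) (.const 0)) <|
  forLoop 5 (.add agents (.const 1)) <|
  setNat 4 (.const 0) (.const (k + 1)) (.add (.entry 4 (.const (k + 1))) (.entry 4 (.const k)))

/-- Writes the allocation that gives to each agent the bundle that she is matched with. -/
def writeOutput : Program :=
  forLoop 5 agents <| forLoop 6 items <|
  setNat 2 (.var 5) (.var 6) (.cell 1 (.entry 13 (.var 5)) (.var 6))

/-- The whole algorithm. The current bundles overwrite the given allocation `X`. -/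
def allocate : Program :=
  seq (setNat 4 (.const 0) (.const 0) (.const 1)) <|
  seq (setPower 0) <| seq (setPower 1) <| seq (setPower 2) <|
  seq (loop (natLe (.var 16) (.const 0)) round) writeOutput

end Programs

/-! ### Verification of the program -/

/-- Row `j` of table `a` is the incidence vector of the bundle `Z j`. -/
def HoldsBundles {n m : ℕ} (a : ℕ) (s : Memory) (Z : Fin n → Finset (Fin m)) : Prop :=
  ∀ (j : Fin n) (g : Fin m), s.nat a j g = if g ∈ Z j then 1 else 0

/-- The memory holds the numbers of agents and items and the valuations. -/
structure HoldsInput {n m : ℕ} (v : Fin n → Fin m → ℝ) (s : Memory) : Prop where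
  agents : s.nat 0 0 0 = n
  items : s.nat 0 0 1 = m
  real : ∀ (i : Fin n) (g : Fin m), s.real 0 i g = v i g

section Specs

variable {n m B : ℕ} {v : Fin n → Fin m → ℝ} {X Z : Fin n → Finset (Fin m)} {s : Memory}

lemma wp_skip (Q : Memory → Prop) : wp B .skip Q s = Q s := rfl

lemma wp_setNat (a : ℕ) (i j x : NatExpr) (Q : Memory → Prop) :
    wp B (.setNat a i j x) Q s = Q (s.setNat a (i.eval s) (j.eval s) (x.eval s)) := rfl

lemma wp_setReal (a : ℕ) (i j : NatExpr) (x : RealExpr) (Q : Memory → Prop) :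
    wp B (.setReal a i j x) Q s = Q (s.setReal a (i.eval s) (j.eval s) (x.eval s)) := rfl

lemma wp_seq (p q : Program) (Q : Memory → Prop) :
    wp B (.seq p q) Q s = wp B p (wp B q Q) s := rfl

lemma wp_cond (b : Test) (p q : Program) (Q : Memory → Prop) :
    wp B (.cond b p q) Q s = ((b.Holds s → wp B p Q s) ∧ (¬ b.Holds s → wp B q Q s)) := rfl

attribute [local simp] wp_skip wp_setNat wp_setReal wp_seq wp_cond Test.Holds Test.natLt
  NatExpr.eval RealExpr.eval NatExpr.var NatExpr.entry agents items
  Memory.setNat_nat Memory.setNat_real Memory.setReal_nat Memory.setReal_real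

lemma HoldsInput.congr (h : HoldsInput v s) {s' : Memory} (hn : s'.nat 0 = s.nat 0)
    (hr : s'.real 0 = s.real 0) : HoldsInput v s' :=
  ⟨by rw [hn, h.agents], by rw [hn, h.items], fun i g => by rw [hr, h.real]⟩

lemma HoldsBundles.congr {a : ℕ} (h : HoldsBundles a s Z) {s' : Memory} (hn : s'.nat a = s.nat a) :
    HoldsBundles a s' Z := fun j g => by rw [hn, h j g]

/-- The memory holds the value and the drop of the bundle `Z j` for agent `i`, and an item of least
value if there is one. -/
def HoldsEval (v : Fin n → Fin m → ℝ) (Z : Fin n → Finset (Fin m)) (i j : Fin n) (s : Memory) :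
    Prop :=
  s.real 1 i j = value v i (Z j) ∧ s.real 2 i j = maxDrop v i (Z j) ∧
    ((Z j).Nonempty → ∃ c : Fin m, s.nat 9 i j = c ∧ c ∈ Z j ∧ ∀ g ∈ Z j, v i c ≤ v i g)

theorem wp_evalBundle (hm : m ≤ B) (hin : HoldsInput v s) (hZ : HoldsBundles 1 s Z) {i j : Fin n}
    (hi : s.nat 5 0 0 = i) (hj : s.nat 6 0 0 = j) :
    wp B evalBundle (fun s' => HoldsEval v Z i j s' ∧ ∀ k l : ℕ, ¬ (k = i ∧ l = j) →
      s'.real 1 k l = s.real 1 k l ∧ s'.real 2 k l = s.real 2 k l ∧ s'.nat 9 k l = s.nat 9 k l)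
      s := by
  simp only [evalBundle, wp_seq, wp_setReal, wp_setNat]
  refine wp_forLoop hm (fun k s' => s'.real 1 i j = ∑ g ∈ Z j with g.1 < k, v i g ∧
    ((s'.nat 9 i j = m ∧ ∀ g ∈ Z j, k ≤ g.1) ∨
      ∃ c : Fin m, s'.nat 9 i j = c ∧ c ∈ Z j ∧ ∀ g ∈ Z j, g.1 < k → v i c ≤ v i g) ∧
    ∀ k l : ℕ, ¬ (k = i ∧ l = j) →
      s'.real 1 k l = s.real 1 k l ∧ s'.nat 9 k l = s.nat 9 k l) rfl ?_ ?_ ?_ ?_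
  · intro s' hF
    have h0 : s'.nat 0 = s.nat 0 := hF.nat 0 rfl
    simp [h0, hin.items]
  · refine ⟨by simp [hi, hj], Or.inl (by simp [hi, hj, hin.items]), fun k l hkl => ?_⟩
    simp [hi, hj, hkl]
  · rintro k hk s' hF h7 ⟨hsum, hleast, hother⟩
    have hin' : HoldsInput v s' := hin.congr (hF.nat 0 rfl) (hF.real 0 rfl)
    have hZ' : HoldsBundles 1 s' Z := hZ.congr (hF.nat 1 rfl)
    have h5 : s'.nat 5 0 0 = i := by rw [← hi]; exact congrFun₂ (hF.nat 5 rfl) 0 0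
    have h6 : s'.nat 6 0 0 = j := by rw [← hj]; exact congrFun₂ (hF.nat 6 rfl) 0 0
    have hbit := hZ' j ⟨k, hk⟩
    have hval := hin'.real i ⟨k, hk⟩
    simp only at hbit hval
    simp only [wp_cond, wp_skip, wp_seq, wp_setNat, wp_setReal, Test.Holds, NatExpr.eval,
      NatExpr.var, h5, h6, h7, hbit]
    refine ⟨fun hg => ?_, fun hg => ?_⟩
    · have hg : (⟨k, hk⟩ : Fin m) ∈ Z j := by
        by_contra hn
        simp [hn] at hg
      have hfilter : (Z j).filter (fun g => g.1 < k + 1)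
          = insert ⟨k, hk⟩ ((Z j).filter fun g => g.1 < k) := by
        ext g
        simp only [mem_filter, mem_insert, Fin.ext_iff]
        constructor
        · rintro ⟨h1, h2⟩
          by_cases hgk : g.1 = k
          · exact Or.inl hgk
          · exact Or.inr ⟨h1, by omega⟩
        · rintro (h1 | ⟨h1, h2⟩)
          · have : g = ⟨k, hk⟩ := Fin.ext h1
            subst this
            exact ⟨hg, by simp⟩
          · exact ⟨h1, by omega⟩
      have hsum' : s'.real 1 i j + s'.real 0 i k = ∑ g ∈ Z j with g.1 < k + 1, v i g := by
        rw [hfilter, sum_insert (by simp), hsum, hval, add_comm]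
      have hlt : ∀ g : Fin m, g.1 < k + 1 → g.1 < k ∨ g = ⟨k, hk⟩ := fun g hgk => by
        rcases Nat.lt_succ_iff_lt_or_eq.1 hgk with h | h
        · exact Or.inl h
        · exact Or.inr (Fin.ext h)
      refine ⟨fun hle => ?_, fun hle => ?_⟩
      · simp [h5, h6, h7, hin'.items, -not_and, -Order.lt_add_one_iff] at hle ⊢
        refine ⟨hsum', Or.inr ?_, fun a b hab => by simpa [hab] using hother a b hab⟩
        obtain ⟨h, -⟩ | ⟨c, hc, hcZ, hmin⟩ := hleast
        · omega
        · refine ⟨c, hc, hcZ, fun g hgZ hgk => ?_⟩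
          rcases hlt g hgk with h | rfl
          · exact hmin g hgZ h
          · rw [hc, hin'.real, hval] at hle
            exact hle.2
      · simp [h5, h6, h7, hin'.items, -not_and, -Order.lt_add_one_iff] at hle ⊢
        refine ⟨hsum', Or.inr ⟨⟨k, hk⟩, rfl, hg, fun g hgZ hgk => ?_⟩,
          fun a b hab => by simpa [hab] using hother a b hab⟩
        rcases hlt g hgk with h | rfl
        · obtain ⟨-, h'⟩ | ⟨c, hc, hcZ, hmin⟩ := hleast
          · have := h' g hgZ; omega
          · rw [hc, hin'.real, hval] at hle
            exact (not_le.1 fun h' => hle ⟨c.2, h'⟩).le.trans (hmin g hgZ h)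
        · exact le_rfl
    · have hg : (⟨k, hk⟩ : Fin m) ∉ Z j := by
        intro hn
        simp [hn] at hg
      have hlt : ∀ g ∈ Z j, (g.1 < k + 1 ↔ g.1 < k) := fun g hgZ => by
        have : g.1 ≠ k := by
          intro hgk
          have : g = ⟨k, hk⟩ := Fin.ext hgk
          exact hg (this ▸ hgZ)
        omega
      refine ⟨?_, ?_, ?_⟩
      · rw [filter_congr hlt]
        exact hsum
      · refine hleast.imp (fun h => ⟨h.1, fun g hgZ => ?_⟩) fun ⟨c, hc, hcZ, hmin⟩ =>
          ⟨c, hc, hcZ, fun g hgZ hgk => hmin g hgZ ((hlt g hgZ).1 hgk)⟩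
        have h1 := h.2 g hgZ
        have h2 := hlt g hgZ
        omega
      · exact hother
  · rintro s' hF ⟨hsum, hleast, hother⟩
    have hin' : HoldsInput v s' := hin.congr (hF.nat 0 rfl) (hF.real 0 rfl)
    have h5 : s'.nat 5 0 0 = i := by rw [← hi]; exact congrFun₂ (hF.nat 5 rfl) 0 0
    have h6 : s'.nat 6 0 0 = j := by rw [← hj]; exact congrFun₂ (hF.nat 6 rfl) 0 0
    have h2 : s'.real 2 = s.real 2 := hF.real 2 rfl
    have hall : (Z j).filter (fun g => g.1 < m) = Z j := filter_true_of_mem fun g _ => g.2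
    rw [hall] at hsum
    refine ⟨fun hlt => ?_, fun hlt => ?_⟩
    · simp [hin'.items, h5, h6] at hlt
      obtain ⟨h, -⟩ | ⟨c, hc, hcZ, hmin⟩ := hleast
      · omega
      have hmin' : ∀ g ∈ Z j, v i c ≤ v i g := fun g hg => hmin g hg g.2
      simp [h5, h6, -not_and]
      refine ⟨⟨?_, ?_, fun _ => ⟨c, hc, hcZ, hmin'⟩⟩, fun a b hab => ?_⟩
      · simpa [value] using hsum
      · simp [hc, hin'.real]
        rw [hsum, maxDrop_eq_of_least hcZ hmin', value_erase _ hcZ, value]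
      · simpa [hab, h2] using hother a b hab
    · simp [hin'.items, h5, h6] at hlt
      have hempty : ∀ g, g ∉ Z j := by
        obtain ⟨-, h⟩ | ⟨c, hc, -, -⟩ := hleast
        · exact fun g hg => absurd (h g hg) (not_le.2 g.2)
        · have := c.2
          omega
      have hempty := eq_empty_of_forall_notMem hempty
      simp [h5, h6, -not_and]
      refine ⟨⟨?_, ?_, fun hne => ?_⟩, fun a b hab => ?_⟩
      · simpa [value] using hsum
      · simp [hempty, maxDrop]
      · simp [hempty] at hne
      · simpa [hab, h2] using hother a b hab

theorem wp_evalAll (hn : n ≤ B) (hm : m ≤ B) (hin : HoldsInput v s) (hZ : HoldsBundles 1 s Z) :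
    wp B evalAll (fun s' => ∀ i j, HoldsEval v Z i j s') s := by
  have hbd : ∀ s', Frame evalAll s s' → agents.eval s' = n := fun s' hF => by
    simp [hF.nat 0 rfl, hin.agents]
  refine wp_forLoop_forLoop hn hn
    (fun i j s' => ∀ (hi : i < n) (hj : j < n), HoldsEval v Z ⟨i, hi⟩ ⟨j, hj⟩ s') rfl rfl rfl
    hbd hbd (fun i j s' x h hi hj => ?_) (fun i j s' x h hi hj => ?_) ?_
    fun s' _ h i j => h i i.2 j j.2 i.2 j.2
  · simpa [HoldsEval] using h hi hj
  · simpa [HoldsEval] using h hi hj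
  · intro i hi j hj s' hF h5 h6
    refine (wp_evalBundle (i := ⟨i, hi⟩) (j := ⟨j, hj⟩) hm (hin.congr (hF.nat 0 rfl)
      (hF.real 0 rfl)) (hZ.congr (hF.nat 1 rfl)) h5 h6).imp
      fun s'' _ ⟨h, hother⟩ => ⟨fun _ _ => h, fun k l hkl hΦ hk hl => ?_⟩
    obtain ⟨h1, h2, h3⟩ := hother k l hkl
    have := hΦ hk hl
    simp only [HoldsEval, h1, h2, h3] at this ⊢
    exact this

theorem wp_findDemands (hn0 : 0 < n) (hn : n ≤ B) (hin : HoldsInput v s)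
    (hdrop : ∀ i j : Fin n, s.real 2 i j = maxDrop v i (Z j)) :
    wp B findDemands (fun s' => ∀ i : Fin n, ∃ j : Fin n, s'.nat 10 0 i = j ∧
      IsRobustDemand v Z i j) s := by
  have hbd : ∀ s', Frame findDemands s s' → agents.eval s' = n := fun s' hF => by
    simp [hF.nat 0 rfl, hin.agents]
  refine wp_forLoop_all hn (fun i s' => ∀ hi : i < n, ∃ j : Fin n, s'.nat 10 0 i = j ∧
      IsRobustDemand v Z ⟨i, hi⟩ j) rfl hbd (fun k s' x h hi => by simpa using h hi) ?_
    fun s' _ h i => h i i.2 i.2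
  intro i hi s' hF h5
  rw [wp_seq, wp_setNat]
  refine wp_forLoop hn (fun k s'' => (∃ j : Fin n, s''.nat 10 0 i = j ∧ ∀ l : Fin n, l.1 < k →
      maxDrop v ⟨i, hi⟩ (Z l) ≤ maxDrop v ⟨i, hi⟩ (Z j)) ∧
      ∀ l, l ≠ i → s''.nat 10 0 l = s'.nat 10 0 l) rfl ?_ ?_ ?_ ?_
  · intro s'' hF'
    simp [hF'.nat 0 rfl, hF.nat 0 rfl, hin.agents]
  · refine ⟨⟨⟨0, hn0⟩, by simp [h5], fun l hl => absurd hl (Nat.not_lt_zero _)⟩, fun l hl => ?_⟩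
    simp [h5, hl]
  · rintro k hk s'' hF' h6 ⟨⟨j, hj, hmax⟩, hother⟩
    have h5' : s''.nat 5 0 0 = i := by rw [hF'.nat 5 rfl]; simpa using h5
    have h2 : s''.real 2 = s.real 2 := by rw [hF'.real 2 rfl, ← hF.real 2 rfl]; rfl
    have hj' := hdrop ⟨i, hi⟩ j
    have hk' := hdrop ⟨i, hi⟩ ⟨k, hk⟩
    simp only at hj' hk'
    have hlt : ∀ l : Fin n, l.1 < k + 1 → l.1 < k ∨ l = ⟨k, hk⟩ := fun l hl => by
      rcases Nat.lt_succ_iff_lt_or_eq.1 hl with h | h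
      · exact Or.inl h
      · exact Or.inr (Fin.ext h)
    simp only [wp_cond, Test.Holds, RealExpr.eval, NatExpr.entry, NatExpr.eval, NatExpr.var, h5',
      h6, hj, h2, hj', hk']
    refine ⟨fun hle => ⟨⟨⟨k, hk⟩, by simp [h5', h6], fun l hl => ?_⟩, fun l hl => ?_⟩,
      fun hle => ⟨⟨j, by simp [hj], fun l hl => ?_⟩, fun l hl => by simp [hother l hl]⟩⟩
    · rcases hlt l hl with h | rfl
      · exact (hmax l h).trans hle
      · exact le_rfl
    · simp [h5', hl, hother l hl]
    · rcases hlt l hl with h | rfl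
      · exact hmax l h
      · exact (not_le.1 hle).le
  · rintro s'' hF' ⟨⟨j, hj, hmax⟩, hother⟩
    refine ⟨fun _ => ⟨j, hj, fun k => hmax k k.2⟩, fun l hl h hl' => ?_⟩
    rw [hother l hl]
    exact h hl'

theorem wp_setWeights (hn : n ≤ B) (hin : HoldsInput v s)
    (hev : ∀ i j, HoldsEval v Z i j s)
    (hrob : ∀ i : Fin n, ∃ j : Fin n, s.nat 10 0 i = j ∧ IsRobustDemand v Z i j)
    (hpow : ∀ k, 0 < k → k ≤ 3 → s.nat 4 0 k = (n + 1) ^ k)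
    (htouched : ∀ j : Fin n, 1 ≤ s.nat 3 0 j ↔ Z j ≠ X j) :
    wp B setWeights (fun s' => ∀ i j : Fin n, s'.nat 11 i j = edgeWeight v X Z i j) s := by
  have hbd : ∀ s', Frame setWeights s s' → agents.eval s' = n := fun s' hF => by
    simp [hF.nat 0 rfl, hin.agents]
  refine wp_forLoop_forLoop hn hn (fun i j s' => ∀ (hi : i < n) (hj : j < n),
    s'.nat 11 i j = edgeWeight v X Z ⟨i, hi⟩ ⟨j, hj⟩) rfl rfl rfl
    hbd hbd (fun i j s' x h hi hj => ?_) (fun i j s' x h hi hj => ?_) ?_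
    fun s' _ h i j => h i i.2 j j.2 i.2 j.2
  · simpa using h hi hj
  · simpa using h hi hj
  · intro i hi j hj s' hF h5 h6
    obtain ⟨r, hr, hrob⟩ := hrob ⟨i, hi⟩
    have hr' : s'.nat 10 0 i = r := by rw [hF.nat 10 rfl]; exact hr
    have hd : s'.real 2 i r = maxDrop v ⟨i, hi⟩ (Z r) := by
      rw [hF.real 2 rfl]; exact (hev ⟨i, hi⟩ r).2.1
    have hij : s'.real 1 i j = value v ⟨i, hi⟩ (Z ⟨j, hj⟩) := by
      rw [hF.real 1 rfl]; exact (hev ⟨i, hi⟩ ⟨j, hj⟩).1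
    have hii : s'.real 1 i i = value v ⟨i, hi⟩ (Z ⟨i, hi⟩) := by
      rw [hF.real 1 rfl]; exact (hev ⟨i, hi⟩ ⟨i, hi⟩).1
    have h3 : 1 ≤ s'.nat 3 0 j ↔ Z ⟨j, hj⟩ ≠ X ⟨j, hj⟩ := by
      rw [hF.nat 3 rfl]; exact htouched ⟨j, hj⟩
    have h4 : s'.nat 4 = s.nat 4 := hF.nat 4 rfl
    have hedge : IsEdge v Z ⟨i, hi⟩ ⟨j, hj⟩ ↔ maxDrop v ⟨i, hi⟩ (Z r) ≤ value v ⟨i, hi⟩ (Z ⟨j, hj⟩)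
        ∧ ¬ (¬ i = j ∧ value v ⟨i, hi⟩ (Z ⟨j, hj⟩) ≤ value v ⟨i, hi⟩ (Z ⟨i, hi⟩)) := by
      simp only [IsEdge, IsFeasible, ne_eq, Fin.mk.injEq, not_and, not_le]
      exact and_congr_left fun _ => ⟨fun h => h r, fun h k => (hrob k).trans h⟩
    have heq : i ≤ j ∧ j ≤ i ↔ i = j := by omega
    have hp1 := hpow 1 (by omega) (by omega)
    have hp2 := hpow 2 (by omega) (by omega)
    have hp3 := hpow 3 (by omega) (by omega)
    rw [pow_one] at hp1
    have hw := edgeWeight.eq_1 v X Z ⟨i, hi⟩ ⟨j, hj⟩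
    simp only [Fin.mk.injEq] at hw
    rw [hedge] at hw
    simp [h5, h6, hr', hd, hij, hii, heq, h3, h4, hp1, hp2, hp3, -not_and]
    refine ⟨fun h1 h2 => ⟨fun h3 => ⟨fun h4 => ?_, fun h4 => ?_⟩,
      fun h3 => ⟨fun h4 => ?_, fun h4 => ?_⟩⟩, fun h1 => ?_⟩
    all_goals
      refine ⟨fun _ _ => ?_, fun k l hkl h hk hl => by simpa only [if_neg hkl] using h hk hl⟩
    · rw [hw, if_pos ⟨h1, h2⟩, if_pos h3, if_pos h4]
    · rw [hw, if_pos ⟨h1, h2⟩, if_pos h3, if_neg (not_not.2 h4), add_zero]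
    · rw [hw, if_pos ⟨h1, h2⟩, if_neg h3, if_pos h4, add_zero]
    · rw [hw, if_pos ⟨h1, h2⟩, if_neg h3, if_neg (not_not.2 h4), add_zero, add_zero]
    · rw [hw, if_neg h1]

/-- Here `ψ i` is the outcome of the test for agent `i`, which the search itself must not affect. -/
theorem wp_findAgent (hn : n ≤ B) (hin : s.nat 0 0 0 = n) {b : Test} {ψ : ℕ → Prop}
    (hb : ∀ s' : Memory, (∀ a, a ≠ 5 → a ≠ 14 → s'.nat a = s.nat a) → s'.nat 5 0 0 < n →
      (b.Holds s' ↔ ψ (s'.nat 5 0 0))) :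
    wp B (findAgent b) (fun s' => (s'.nat 14 0 0 = n ∧ ∀ i < n, ¬ ψ i) ∨
      (s'.nat 14 0 0 < n ∧ ψ (s'.nat 14 0 0))) s := by
  have hfr : ∀ {s' : Memory} {p : Program}, Frame p s s' →
      (∀ a, a ≠ 5 → a ≠ 14 → p.writesNat a = false) →
      ∀ a, a ≠ 5 → a ≠ 14 → s'.nat a = s.nat a := fun hF hp a h1 h2 => hF.nat a (hp a h1 h2)
  rw [findAgent, wp_seq, wp_setNat]
  set s₀ := s.setNat 14 ((NatExpr.const 0).eval s) ((NatExpr.const 0).eval s) (agents.eval s)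
    with hs₀
  have h₀ : ∀ a, a ≠ 14 → s₀.nat a = s.nat a := fun a ha => by
    funext k l
    simp [hs₀, ha]
  have hF0 : ∀ s', Frame (.forLoop 5 agents
      (.cond b (.setNat 14 (.const 0) (.const 0) (.var 5)) .skip)) s₀ s' →
      ∀ a, a ≠ 5 → a ≠ 14 → s'.nat a = s.nat a := fun s' hF a h1 h2 => by
    rw [hF.nat a (by simp [Program.forLoop, Program.writesNat, h1, h2]), h₀ a h2]
  refine wp_forLoop hn (fun k s' => (s'.nat 14 0 0 = n ∧ ∀ i < k, ¬ ψ i) ∨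
      (s'.nat 14 0 0 < n ∧ ψ (s'.nat 14 0 0))) rfl ?_ ?_ ?_ fun _ _ h => h
  · intro s' hF
    simp [hF0 s' hF 0, hin]
  · left
    simp [hs₀, hin]
  · intro k hk s' hF h5 hI
    have hb' := hb s' (hF0 s' hF) (h5 ▸ hk)
    rw [h5] at hb'
    rw [wp_cond, hb']
    refine ⟨fun hψ => Or.inr ?_, fun hψ => ?_⟩
    · simp [h5, hψ, hk]
    · refine hI.imp (fun h => ⟨by simp [h.1], fun i hi => ?_⟩) fun h => by simpa using h
      rcases Nat.lt_succ_iff_lt_or_eq.1 hi with h' | rfl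
      · exact h.2 i h'
      · exact hψ

theorem wp_makeBid {C : ℕ} (hn : n ≤ B) (hin : s.nat 0 0 0 = n)
    (hw : ∀ i < n, ∀ j < n, s.nat 11 i j ≤ C)
    (hinv : AuctionInv n C (s.nat 11) (s.nat 12 0) (s.nat 13 0))
    (hu : s.nat 14 0 0 < n) (hfree : n ≤ s.nat 13 0 (s.nat 14 0 0)) :
    wp B makeBid (fun s' => AuctionInv n C (s.nat 11) (s'.nat 12 0) (s'.nat 13 0) ∧
      ∑ j ∈ range n, s'.nat 12 0 j = ∑ j ∈ range n, s.nat 12 0 j + 1) s := by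
  simp only [makeBid, wp_seq, wp_setNat]
  refine wp_forLoop hn (fun k s' => s'.nat 15 0 0 < n ∧ ∀ l < k,
    s.nat 11 (s.nat 14 0 0) l + s.nat 12 0 (s'.nat 15 0 0)
      ≤ s.nat 11 (s.nat 14 0 0) (s'.nat 15 0 0) + s.nat 12 0 l) rfl ?_ ?_ ?_ ?_
  · intro s' hF
    have := hF.nat 0 rfl
    simp [this, hin]
  · simp only [NatExpr.eval, Memory.setNat_nat]
    simp
    omega
  · rintro k hk s' hF h6 ⟨hlt, hmax⟩
    have h11 : s'.nat 11 = s.nat 11 := hF.nat 11 rfl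
    have h12 : s'.nat 12 = s.nat 12 := hF.nat 12 rfl
    have h14 : s'.nat 14 = s.nat 14 := hF.nat 14 rfl
    simp only [wp_cond, wp_skip, wp_setNat, Test.Holds, NatExpr.eval, NatExpr.var, NatExpr.entry,
      h6, h11, h12, h14]
    refine ⟨fun hle => ?_, fun hle => ?_⟩
    · simp only [Memory.setNat_nat]
      simp
      refine ⟨hk, fun l hl => ?_⟩
      rcases Nat.lt_succ_iff_lt_or_eq.1 (Nat.lt_succ_of_le hl) with h | rfl
      · have := hmax l h
        omega
      · exact le_rfl
    · simp only [Memory.setNat_nat]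
      simp
      refine ⟨hlt, fun l hl => ?_⟩
      rcases Nat.lt_succ_iff_lt_or_eq.1 (Nat.lt_succ_of_le hl) with h | rfl
      · exact hmax l h
      · omega
  · rintro s₁ hF₁ ⟨hb, hbest⟩
    set b := s₁.nat 15 0 0 with hbdef
    have h0 : s₁.nat 0 = s.nat 0 := hF₁.nat 0 rfl
    have h12 : s₁.nat 12 = s.nat 12 := hF₁.nat 12 rfl
    have h13 : s₁.nat 13 = s.nat 13 := hF₁.nat 13 rfl
    have h14 : s₁.nat 14 = s.nat 14 := hF₁.nat 14 rfl
    refine wp_forLoop hn (fun k s' => ∀ i,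
      s'.nat 13 0 i = if i < k ∧ s.nat 13 0 i = b then n else s.nat 13 0 i) rfl ?_ ?_ ?_ ?_
    · intro s' hF
      have := hF.nat 0 rfl
      simp [this, h0, hin]
    · intro i
      simp [h13]
    · intro k hk s' hF h5 hI
      have h15 : s'.nat 15 0 0 = b := by rw [hF.nat 15 rfl]; simp [hbdef]
      have h0' : s'.nat 0 0 0 = n := by rw [hF.nat 0 rfl]; simp [h0, hin]
      have hk' := hI k
      simp only [lt_irrefl, false_and, if_false] at hk'
      simp only [wp_cond, wp_skip, wp_setNat, Test.Holds, NatExpr.eval, NatExpr.var, NatExpr.entry,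
        agents, h5, h15, h0', hk']
      refine ⟨fun hle i => ?_, fun hle i => ?_⟩
      · simp only [Memory.setNat_nat]
        by_cases hik : i = k
        · subst hik
          have : s.nat 13 0 i = b := by omega
          simp [this]
        · have : i < k + 1 ↔ i < k := by omega
          simp only [this]
          simp [hik, hI i]
      · simp only [Memory.setNat_nat]
        by_cases hik : i = k
        · subst hik
          have : s.nat 13 0 i ≠ b := by omega
          simp [this, hk']
        · have : i < k + 1 ↔ i < k := by omega
          simp only [this]
          simp [hI i]
    · intro s₂ hF₂ hI
      have h15 : s₂.nat 15 0 0 = b := by rw [hF₂.nat 15 rfl]; simp [hbdef]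
      have h14' : s₂.nat 14 = s.nat 14 := by rw [hF₂.nat 14 rfl, ← h14]; rfl
      have h12' : ∀ j, s₂.nat 12 0 j = if j = b then s.nat 12 0 b + 1 else s.nat 12 0 j := by
        intro j
        rw [hF₂.nat 12 rfl]
        simp [h12, ← hbdef]
      have hasg : ∀ i, (s₂.setNat 13 0 (s.nat 14 0 0) b).nat 13 0 i = if i = s.nat 14 0 0 then b
          else if i < n ∧ s.nat 13 0 i = b then n else s.nat 13 0 i := by
        intro i
        simp [hI i]
      have hprice : (s₂.setNat 13 0 (s.nat 14 0 0) b).nat 12 0 = s₂.nat 12 0 := rfl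
      simp only [wp_setNat, NatExpr.eval, NatExpr.var, h14', h15]
      rw [hprice]
      refine ⟨hinv.bid hw hu hfree hb hbest ?_ ?_ ?_ ?_ ?_, ?_⟩
      · rw [h12', if_pos rfl]
      · intro j _ hj
        rw [h12', if_neg hj]
      · rw [hasg, if_pos rfl]
      · intro i hi hiu hib
        rw [hasg, if_neg hiu, if_pos ⟨hi, hib⟩]
      · intro i hi hiu hib
        rw [hasg, if_neg hiu, if_neg fun h => hib h.2]
      · rw [← add_sum_erase _ _ (mem_range.2 hb), ← add_sum_erase _ (s.nat 12 0) (mem_range.2 hb),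
          h12', if_pos rfl]
        have : ∀ j ∈ (range n).erase b, s₂.nat 12 0 j = s.nat 12 0 j := fun j hj => by
          rw [h12', if_neg (mem_erase.1 hj).1]
        rw [sum_congr rfl this]
        ring

theorem wp_auction {C : ℕ} (hn : n ≤ B) (hB : n * (C + 1) ≤ B) (hin : s.nat 0 0 0 = n)
    (hw : ∀ i < n, ∀ j < n, s.nat 11 i j ≤ C) :
    wp B auction (fun s' => (∃ p, AuctionInv n C (s.nat 11) p (s'.nat 13 0)) ∧
      ∀ i < n, s'.nat 13 0 i < n) s := by
  have hfind : ∀ s₁ : Memory, s₁.nat 0 0 0 = n →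
      wp B (findAgent (.natLe agents (.entry 13 (.var 5)))) (fun s' =>
        (s'.nat 14 0 0 = n ∧ ∀ i < n, ¬ n ≤ s'.nat 13 0 i) ∨
        (s'.nat 14 0 0 < n ∧ n ≤ s'.nat 13 0 (s'.nat 14 0 0))) s₁ := by
    intro s₁ h0
    refine (wp_findAgent (ψ := fun i => n ≤ s₁.nat 13 0 i) hn h0 fun s' h _ => ?_).imp
      fun s' hF h => ?_
    · simp [h 0, h 13, h0]
    · rw [hF.nat 13 rfl]
      exact h
  rw [auction, wp_seq]
  refine wp_forLoop_all hn (fun i s' => s'.nat 12 0 i = 0 ∧ s'.nat 13 0 i = n) rfl ?_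
    (fun k s' x h => by simpa using h) ?_ ?_
  · intro s' hF
    simp [hF.nat 0 rfl, hin]
  · intro k hk s' hF h5
    have h0 : s'.nat 0 0 0 = n := by rw [hF.nat 0 rfl, hin]
    simp only [wp_seq, wp_setNat]
    refine ⟨by simp [h5, h0], fun l hl h => ?_⟩
    simpa [h5, hl] using h
  · intro s₁ hF₁ hinit
    have h0 : s₁.nat 0 0 0 = n := by rw [hF₁.nat 0 rfl, hin]
    rw [wp_seq]
    refine (hfind s₁ h0).imp fun s₂ hF₂ h₂ => ?_
    have h12 : s₂.nat 12 = s₁.nat 12 := hF₂.nat 12 rfl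
    have h13 : s₂.nat 13 = s₁.nat 13 := hF₂.nat 13 rfl
    -- Each bid raises the sum of the prices by `1`, and this sum is at most `n * (C + 1)`.
    refine ⟨fun f s' => s'.nat 0 = s.nat 0 ∧ s'.nat 11 = s.nat 11 ∧
      AuctionInv n C (s.nat 11) (s'.nat 12 0) (s'.nat 13 0) ∧
      f + ∑ j ∈ range n, s'.nat 12 0 j = n * (C + 1) ∧
      ((s'.nat 14 0 0 = n ∧ ∀ i < n, ¬ n ≤ s'.nat 13 0 i) ∨
        (s'.nat 14 0 0 < n ∧ n ≤ s'.nat 13 0 (s'.nat 14 0 0))),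
      ⟨n * (C + 1), hB, ?_, ?_, ?_, ?_, h₂⟩, ?_⟩
    · rw [hF₂.nat 0 rfl, hF₁.nat 0 rfl]
    · rw [hF₂.nat 11 rfl, hF₁.nat 11 rfl]
    · rw [h12, h13]
      exact .start n C _ (fun j hj => (hinit j hj).1) fun i hi => (hinit i hi).2
    · rw [h12, sum_eq_zero fun j hj => (hinit j (mem_range.1 hj)).1, add_zero]
    · rintro f s' ⟨h0', h11, hinv, hf, hcase⟩
      have h0n : s'.nat 0 0 0 = n := by rw [h0', hin]
      have htest : (Test.natLt (.var 14) agents).Holds s' ↔ s'.nat 14 0 0 < n := by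
        simp only [Test.natLt, Test.Holds, NatExpr.eval, NatExpr.var, agents, h0n]
        exact Iff.rfl
      refine ⟨fun hb => ?_, fun hb => ?_⟩
      · have hu := htest.1 hb
        have hfree := (hcase.resolve_left fun h => by omega).2
        rw [wp_seq]
        refine (wp_makeBid (C := C) hn h0n (by rwa [h11]) (by rwa [h11]) hu hfree).imp
          fun s₃ hF₃ ⟨hinv₃, hsum₃⟩ => ?_
        have h0₃ : s₃.nat 0 = s.nat 0 := by rw [hF₃.nat 0 rfl, h0']
        have h11₃ : s₃.nat 11 = s.nat 11 := by rw [hF₃.nat 11 rfl, h11]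
        refine (hfind s₃ (by rw [h0₃, hin])).imp fun s₄ hF₄ h₄ => ?_
        have h12₄ : s₄.nat 12 = s₃.nat 12 := hF₄.nat 12 rfl
        have h13₄ : s₄.nat 13 = s₃.nat 13 := hF₄.nat 13 rfl
        have hle : ∑ j ∈ range n, s₃.nat 12 0 j ≤ n * (C + 1) := by
          refine (sum_le_card_nsmul _ _ (C + 1) fun j hj =>
            hinv₃.price_le j (mem_range.1 hj)).trans_eq ?_
          simp
        refine ⟨f - 1, by omega, by rw [hF₄.nat 0 rfl, h0₃], by rw [hF₄.nat 11 rfl, h11₃], ?_, ?_,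
          h₄⟩
        · rw [h12₄, h13₄, ← h11]
          exact hinv₃
        · rw [h12₄]
          omega
      · rw [htest] at hb
        obtain h | h := hcase
        · exact ⟨⟨_, hinv⟩, fun i hi => not_le.1 (h.2 i hi)⟩
        · exact absurd h.1 hb

theorem wp_setPower (k : ℕ) (hn : n + 1 ≤ B) (hin : s.nat 0 0 0 = n) :
    wp B (setPower k) (fun s' => s'.nat 4 0 (k + 1) = (n + 1) * s.nat 4 0 k ∧
      ∀ l, l ≠ k + 1 → s'.nat 4 0 l = s.nat 4 0 l) s := by
  simp only [setPower, wp_seq, wp_setNat]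
  refine wp_forLoop hn (fun t s' => s'.nat 4 0 (k + 1) = t * s.nat 4 0 k ∧
      ∀ l, l ≠ k + 1 → s'.nat 4 0 l = s.nat 4 0 l) rfl ?_ ?_ ?_ fun _ _ h => h
  · intro s' hF
    have := hF.nat 0 rfl
    simp [this, hin]
  · refine ⟨by simp, fun l hl => by simp [hl]⟩
  · rintro t _ s' hF - ⟨h1, h2⟩
    have h3 := h2 k (by omega)
    refine ⟨?_, fun l hl => ?_⟩
    · simp [h1, h3, add_one_mul]
    · simp [hl, h2 l hl]

theorem wp_writeOutput (hn : n ≤ B) (hm : m ≤ B) (hin : HoldsInput v s) (hZ : HoldsBundles 1 s Z)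
    {σ : Equiv.Perm (Fin n)} (hσ : ∀ i : Fin n, s.nat 13 0 i = σ i) :
    wp B writeOutput (fun s' => HoldsOutput s' fun i => Z (σ i)) s := by
  refine wp_forLoop_forLoop hn hm (fun i g s' => ∀ (hi : i < n) (hg : g < m),
    s'.nat 2 i g = if (⟨g, hg⟩ : Fin m) ∈ Z (σ ⟨i, hi⟩) then 1 else 0) rfl rfl rfl
    (fun s' hF => ?_) (fun s' hF => ?_) (fun i j s' x h hi hj => ?_)
    (fun i j s' x h hi hj => ?_) ?_ fun s' _ h i g => h i i.2 g g.2 i.2 g.2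
  · simp [hF.nat 0 rfl, hin.agents]
  · simp [hF.nat 0 rfl, hin.items]
  · simpa using h hi hj
  · simpa using h hi hj
  · intro i hi g hg s' hF h5 h6
    have h13 := hσ ⟨i, hi⟩
    have h1 := hZ (σ ⟨i, hi⟩) ⟨g, hg⟩
    simp only at h13 h1
    refine ⟨fun _ _ => ?_, fun k l hkl h hk hl => ?_⟩
    · simp [h5, h6, hF.nat 13 rfl, hF.nat 1 rfl, h13, h1]
    · simp only [Memory.setNat_nat, NatExpr.eval, NatExpr.var, h5, h6, true_and, if_neg hkl]
      exact h hk hl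

/-- The memory between two rounds: the algorithm holds the bundles `Z` after `k` removals. -/
structure RoundState (v : Fin n → Fin m → ℝ) (X Z : Fin n → Finset (Fin m)) (k : ℕ) (s : Memory) :
    Prop where
  input : HoldsInput v s
  power : ∀ k, 0 < k → k ≤ 3 → s.nat 4 0 k = (n + 1) ^ k
  reaches : Reaches v X k Z
  bundles : HoldsBundles 1 s Z
  touched : ∀ j : Fin n, 1 ≤ s.nat 3 0 j ↔ Z j ≠ X j

/-- The memory holds in table `13` a selected matching of all agents. -/
def HoldsPerfect (v : Fin n → Fin m → ℝ) (X Z : Fin n → Finset (Fin m)) (s : Memory) : Prop :=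
  ∃ σ : Equiv.Perm (Fin n), (∀ i : Fin n, s.nat 13 0 i = σ i) ∧
    IsSelected v X Z (univ.image fun i => (i, σ i))

/-- A round either passes to a state with one more item removed or raises the flag in variable `16`
and leaves a perfect selected matching. -/
theorem wp_round (hinp : IsInput n m v X) (hn : n ≤ B) (hm : m ≤ B)
    (hB : n * ((n + 1) + (n + 1) ^ 2 + (n + 1) ^ 3 + 1) ≤ B) {k : ℕ}
    (hs : RoundState v X Z k s) :
    wp B round (fun s' =>
      ((∃ Z', RoundState v X Z' (k + 1) s') ∧ s'.nat 16 0 0 = s.nat 16 0 0) ∨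
      (RoundState v X Z k s' ∧ s'.nat 16 0 0 = 1 ∧ HoldsPerfect v X Z s')) s := by
  classical
  obtain ⟨hin, hpow, hr, hZ, htouched⟩ := hs
  simp only [round, wp_seq]
  refine (wp_evalAll hn hm hin hZ).imp fun s₁ hF₁ hev => ?_
  have hin₁ : HoldsInput v s₁ := hin.congr (hF₁.nat 0 rfl) (hF₁.real 0 rfl)
  refine (wp_findDemands hinp.1 hn hin₁ fun i j => (hev i j).2.1).imp fun s₂ hF₂ hrob => ?_
  have hin₂ : HoldsInput v s₂ := hin₁.congr (hF₂.nat 0 rfl) (hF₂.real 0 rfl)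
  have hev₂ : ∀ i j, HoldsEval v Z i j s₂ := fun i j => by
    rw [HoldsEval, hF₂.real 1 rfl, hF₂.real 2 rfl, hF₂.nat 9 rfl]
    exact hev i j
  refine (wp_setWeights (X := X) hn hin₂ hev₂ hrob (fun k => ?_) (fun j => ?_)).imp
    fun s₃ hF₃ hw => ?_
  · rw [hF₂.nat 4 rfl, hF₁.nat 4 rfl]
    exact hpow k
  · rw [hF₂.nat 3 rfl, hF₁.nat 3 rfl]
    exact htouched j
  have hin₃ : HoldsInput v s₃ := hin₂.congr (hF₃.nat 0 rfl) (hF₃.real 0 rfl)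
  refine (wp_auction hn hB hin₃.agents fun i hi j hj => ?_).imp fun s₄ hF₄ ⟨⟨p, hp⟩, hasg⟩ => ?_
  · rw [hw ⟨i, hi⟩ ⟨j, hj⟩]
    exact edgeWeight_le _ _
  obtain ⟨σ, hσ, hopt⟩ := hp.exists_perm hasg
  have hsel : IsSelected v X Z
      ((univ.filter fun i => IsEdge v Z i (σ i)).image fun i => (i, σ i)) := by
    refine isSelected_of_weight (hr.exists_matching hinp.2.1) fun M hM => ?_
    have := hopt M hM.2
    simpa only [hw] using this
  have hin₄ : HoldsInput v s₄ := hin₃.congr (hF₄.nat 0 rfl) (hF₄.real 0 rfl)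
  refine (wp_findAgent (ψ := fun i => s₄.nat 11 i (s₄.nat 13 0 i) = 0) hn hin₄.agents
    fun s' h _ => ?_).imp fun s₅ hF₅ hfound => ?_
  · simp [h 11, h 13]
  have h0 : s₅.nat 0 = s.nat 0 := by
    rw [hF₅.nat 0 rfl, hF₄.nat 0 rfl, hF₃.nat 0 rfl, hF₂.nat 0 rfl, hF₁.nat 0 rfl]
  have h1 : s₅.nat 1 = s.nat 1 := by
    rw [hF₅.nat 1 rfl, hF₄.nat 1 rfl, hF₃.nat 1 rfl, hF₂.nat 1 rfl, hF₁.nat 1 rfl]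
  have h3 : s₅.nat 3 = s.nat 3 := by
    rw [hF₅.nat 3 rfl, hF₄.nat 3 rfl, hF₃.nat 3 rfl, hF₂.nat 3 rfl, hF₁.nat 3 rfl]
  have h4 : s₅.nat 4 = s.nat 4 := by
    rw [hF₅.nat 4 rfl, hF₄.nat 4 rfl, hF₃.nat 4 rfl, hF₂.nat 4 rfl, hF₁.nat 4 rfl]
  have h9 : s₅.nat 9 = s₁.nat 9 := by
    rw [hF₅.nat 9 rfl, hF₄.nat 9 rfl, hF₃.nat 9 rfl, hF₂.nat 9 rfl]
  have h10 : s₅.nat 10 = s₂.nat 10 := by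
    rw [hF₅.nat 10 rfl, hF₄.nat 10 rfl, hF₃.nat 10 rfl]
  have h16 : s₅.nat 16 = s.nat 16 := by
    rw [hF₅.nat 16 rfl, hF₄.nat 16 rfl, hF₃.nat 16 rfl, hF₂.nat 16 rfl, hF₁.nat 16 rfl]
  have hr0 : s₅.real 0 = s.real 0 := by
    rw [hF₅.real 0 rfl, hF₄.real 0 rfl, hF₃.real 0 rfl, hF₂.real 0 rfl, hF₁.real 0 rfl]
  have hin₅ : HoldsInput v s₅ := hin.congr h0 hr0
  have hψ : ∀ i : Fin n, s₄.nat 11 i (s₄.nat 13 0 i) = 0 ↔ ¬ IsEdge v Z i (σ i) := fun i => by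
    rw [hF₄.nat 11 rfl, ← hσ i, hw, edgeWeight_eq_zero_iff]
  have htest : (Test.natLt (.var 14) agents).Holds s₅ ↔ s₅.nat 14 0 0 < n := by
    simp only [Test.natLt, Test.Holds, NatExpr.eval, NatExpr.var, agents, hin₅.agents]
    exact Iff.rfl
  rw [wp_cond, htest]
  refine ⟨fun hlt => Or.inl ?_, fun hlt => Or.inr ?_⟩
  · obtain ⟨hu, hedge⟩ := hfound.resolve_left fun h => by omega
    obtain ⟨i, hi⟩ : ∃ i : Fin n, s₅.nat 14 0 0 = i := ⟨⟨_, hu⟩, rfl⟩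
    rw [hi, hψ] at hedge
    obtain ⟨j, hj, hdem⟩ := hrob i
    have hunm : IsUnmatched
        ((univ.filter fun i => IsEdge v Z i (σ i)).image fun i => (i, σ i)) i := by
      intro e he hei
      obtain ⟨i', hi', rfl⟩ := mem_image.1 he
      simp only at hei
      subst hei
      exact hedge (mem_filter.1 hi').2
    obtain ⟨c, hc, hcZ, hmin⟩ := (hev i j).2.2 (hsel.robustDemand_nonempty hinp.2.1 hunm hdem)
    simp only [NatExpr.eval, NatExpr.var, NatExpr.entry, hi, h10, hj, h9, hc]
    simp only [Memory.setNat_nat, h10, hi]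
    simp only [show (14 : ℕ) ≠ 1 by decide, show (10 : ℕ) ≠ 1 by decide, false_and, if_false, hj]
    refine ⟨⟨Function.update Z j ((Z j).erase c), ?_, ?_, ?_, ?_, ?_⟩, ?_⟩
    · exact hin₅.congr rfl rfl
    · intro k hk hk3
      rw [← hpow k hk hk3, ← h4]
      rfl
    · exact hr.next ⟨_, i, j, c, hsel, hunm, hdem, hcZ, hmin, rfl⟩
    · intro b g
      have := hZ b g
      rw [← h1] at this
      simp only [Memory.setNat_nat]
      by_cases hb : b = j
      · subst hb
        by_cases hg : g = c
        · subst hg; simp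
        · simp [hg, this, Fin.val_inj]
      · simp [hb, this, Fin.val_inj]
    · intro b
      have := htouched b
      rw [← h3] at this
      simp only [Memory.setNat_nat]
      by_cases hb : b = j
      · subst hb
        have hne : (Z b).erase c ≠ X b := fun h => by
          have := hr.subset b hcZ
          rw [← h] at this
          simp at this
        simp [hne]
      · simp [hb, this, Fin.val_inj]
    · simp [h16]
  · have hall := (hfound.resolve_right fun h => hlt h.1).2
    have huniv : (univ.filter fun i => IsEdge v Z i (σ i)) = univ :=
      filter_true_of_mem fun i _ => not_not.1 (mt (hψ i).2 (hall i i.2))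
    rw [huniv] at hsel
    simp only [NatExpr.eval]
    refine ⟨⟨hin₅.congr rfl rfl, fun k hk hk3 => ?_, hr, hZ.congr h1, fun j => ?_⟩, by simp,
      σ, fun i => ?_, hsel⟩
    · rw [← hpow k hk hk3, ← h4]
      rfl
    · rw [← htouched j, ← h3]
      rfl
    · rw [hσ i, ← hF₅.nat 13 rfl]
      rfl

theorem wp_allocate (hinp : IsInput n m v X) (hn : n + 1 ≤ B) (hm : m + 1 ≤ B)
    (hB : n * ((n + 1) + (n + 1) ^ 2 + (n + 1) ^ 3 + 1) ≤ B) :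
    wp B allocate (fun s => ∃ Y : Fin n → Finset (Fin m), HoldsOutput s Y ∧ Returns v X Y)
      (inputMemory v X) := by
  set s := inputMemory v X with hs
  have h0 : s.nat 0 0 0 = n := by simp [hs, inputMemory]
  have hin : HoldsInput v s :=
    ⟨h0, by simp [hs, inputMemory], fun i g => by simp [hs, inputMemory]⟩
  have hX : HoldsBundles 1 s X := fun j g => by simp [hs, inputMemory]
  have h3 : ∀ j, s.nat 3 0 j = 0 := fun j => by simp [hs, inputMemory]
  have h16 : s.nat 16 0 0 = 0 := by simp [hs, inputMemory]
  simp only [allocate, wp_seq, wp_setNat]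
  set s₀ := s.setNat 4 ((NatExpr.const 0).eval s) ((NatExpr.const 0).eval s)
    ((NatExpr.const 1).eval s) with hs₀
  refine (wp_setPower 0 hn (s := s₀) h0).imp fun s₁ hF₁ ⟨h₁, _⟩ => ?_
  have h0₁ : s₁.nat 0 = s.nat 0 := hF₁.nat 0 rfl
  refine (wp_setPower 1 hn (by rw [h0₁, h0])).imp fun s₂ hF₂ ⟨h₂, h₂'⟩ => ?_
  have h0₂ : s₂.nat 0 = s.nat 0 := (hF₂.nat 0 rfl).trans h0₁
  refine (wp_setPower 2 hn (by rw [h0₂, h0])).imp fun s₃ hF₃ ⟨h₃, h₃'⟩ => ?_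
  have h0₃ : s₃.nat 0 = s.nat 0 := (hF₃.nat 0 rfl).trans h0₂
  have hr0 : s₃.real 0 = s.real 0 := by
    rw [hF₃.real 0 rfl, hF₂.real 0 rfl, hF₁.real 0 rfl]; rfl
  have h1₃ : s₃.nat 1 = s.nat 1 := by
    rw [hF₃.nat 1 rfl, hF₂.nat 1 rfl, hF₁.nat 1 rfl]; rfl
  have h3₃ : s₃.nat 3 = s.nat 3 := by
    rw [hF₃.nat 3 rfl, hF₂.nat 3 rfl, hF₁.nat 3 rfl]; rfl
  have h16₃ : s₃.nat 16 = s.nat 16 := by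
    rw [hF₃.nat 16 rfl, hF₂.nat 16 rfl, hF₁.nat 16 rfl]; rfl
  have hp0 : s₀.nat 4 0 0 = 1 := by simp [hs₀]
  have hstart : RoundState v X X 0 s₃ := by
    refine ⟨hin.congr h0₃ hr0, fun k hk hk3 => ?_, .start, hX.congr h1₃, fun j => ?_⟩
    · have e1 : s₁.nat 4 0 1 = n + 1 := by rw [h₁, hp0, mul_one]
      have e2 : s₂.nat 4 0 2 = (n + 1) ^ 2 := by rw [h₂, e1]; ring
      obtain rfl | rfl | rfl : k = 1 ∨ k = 2 ∨ k = 3 := by omega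
      · rw [h₃' 1 (by omega), h₂' 1 (by omega), e1, pow_one]
      · rw [h₃' 2 (by omega), e2]
      · rw [h₃, e2]; ring
    · simp [h3₃, h3]
  -- At most `m` items can be removed; one more round raises the flag.
  refine ⟨fun f s' => ∃ k Z, RoundState v X Z k s' ∧ ((s'.nat 16 0 0 = 0 ∧ k + f = m + 1) ∨
    (s'.nat 16 0 0 = 1 ∧ HoldsPerfect v X Z s')),
    ⟨m + 1, hm, 0, X, hstart, Or.inl ⟨by rw [h16₃, h16], by omega⟩⟩, ?_⟩
  rintro f s' ⟨k, Z, hst, hcase⟩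
  have htest : (Test.natLe (.var 16) (.const 0)).Holds s' ↔ s'.nat 16 0 0 ≤ 0 := Iff.rfl
  rw [htest]
  refine ⟨fun h => ?_, fun h => ?_⟩
  · obtain ⟨hzero, hf⟩ := hcase.resolve_right fun h' => by omega
    have hk := (hinp.alwaysTerminates k Z hst.reaches).1
    refine (wp_round hinp (by omega) (by omega) hB hst).imp fun s'' _ h'' => ?_
    obtain ⟨⟨Z', hst'⟩, h16'⟩ | ⟨hst', h16', hperf⟩ := h''
    · exact ⟨f - 1, by omega, k + 1, Z', hst', Or.inl ⟨by rw [h16', hzero], by omega⟩⟩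
    · exact ⟨0, by omega, k, Z, hst', Or.inr ⟨h16', hperf⟩⟩
  · obtain ⟨-, σ, hσ, hsel⟩ := hcase.resolve_left fun h' => by omega
    refine (wp_writeOutput (by omega) (by omega) hst.input hst.bundles hσ).imp fun s'' _ hout => ?_
    refine ⟨_, hout, k, Z, _, hst.reaches, hsel, ?_, fun e he => ?_⟩
    · rw [card_image_of_injective _ fun i j hij => congrArg Prod.fst hij, card_univ,
        Fintype.card_fin]
    · obtain ⟨i, -, rfl⟩ := mem_image.1 he
      rfl

theorem runsInPolynomialTime_isInput : RunsInPolynomialTime IsInput := by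
  refine ⟨allocate, allocate.timeBound.comp ((Polynomial.X + 2) ^ 4), fun n m v X hinp => ?_⟩
  -- The bound on the number of bids in an auction is `(n + 1) ^ 4 - 1`.
  have hpow : ∀ a : ℕ, a ≤ n + m + 2 → a ≤ (n + m + 2) ^ 4 := fun a ha =>
    ha.trans (Nat.le_self_pow (by norm_num) _)
  have hB : n * ((n + 1) + (n + 1) ^ 2 + (n + 1) ^ 3 + 1) ≤ (n + m + 2) ^ 4 := by
    have h1 : n * ((n + 1) + (n + 1) ^ 2 + (n + 1) ^ 3 + 1) + 1 = (n + 1) ^ 4 := by ring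
    have h2 : (n + 1) ^ 4 ≤ (n + m + 2) ^ 4 := Nat.pow_le_pow_left (by omega) 4
    omega
  obtain ⟨t, s, hrun, ht, Y, hY, hret⟩ := (wp_allocate hinp (hpow (n + 1) (by omega))
    (hpow (m + 1) (by omega)) hB).runs
  exact ⟨t, s, Y, hrun, by simpa using ht, hY, hret⟩

end Specs

end FairDivision

theorem theorem2 :
    FairDivision.RunsInPolynomialTime FairDivision.IsInput ∧
    ∀ (n m : ℕ) (v : Fin n → Fin m → ℝ) (X : Fin n → Finset (Fin m)),
      FairDivision.IsInput n m v X →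
      FairDivision.AlwaysTerminates v X ∧
      ∀ Y : Fin n → Finset (Fin m), FairDivision.Returns v X Y →
        FairDivision.IsAllocation (FairDivision.allocated Y) Y ∧
        FairDivision.IsEFX v Y ∧
        FairDivision.IsEfficient v ((2 : ℝ) ^ (1 - 1 / (n : ℝ))) Y ∧
        ((0 < FairDivision.opt v univ ∨ ∀ i g, 0 < v i g) → ∀ i, Y i ⊆ X i) ∧
        (0 < FairDivision.opt v univ →
          FairDivision.IsParetoOptimal v (FairDivision.allocated Y) Y ∧
          (∀ i, FairDivision.value v i (X i) ≤ 2 * FairDivision.value v i (Y i)) ∧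
          ∃ i, Y i = X i) :=
  ⟨FairDivision.runsInPolynomialTime_isInput, fun _ _ _ _ h =>
    ⟨h.alwaysTerminates, fun _ hY => h.returns hY⟩⟩
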